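/- **Theorem 3.** For a real matrix $M$, let $\|M\|_{1\to 2}$ be the largest Euclidean norm of a column of $M$, let $\|M\|_{2\to\infty}$ be the largest Euclidean norm of a row of $M$ (each is $0$ if there are no columns, respectively rows), and let $\gamma_2(M)=\min\{\|L\|_{2\to\infty}\|R\|_{1\to 2} : LR=M\}$, the inner dimension being arbitrary. *Row arrival model.* The rows $q_1,q_2,\dots\in\mathbb{R}^N$ of a matrix arrive one at a time. A (deterministic) online factorization algorithm fixes an initial, possibly empty, matrix $R_0$ with $N$ columns. When $q_t$ arrives, it forms $R_t$ by adding (zero or more) rows to $R_{t-1}$ and outputs a row vector $\ell_t$ with $\ell_tR_t=q_t$; both may depend only on $q_1,\dots,q_t$ (and on $N$), in particular not on the total number of rows. It must always hold that $\|R_t\|_{1\to2}\le 1$. The algorithm achieves value $\gamma$ on an $m\times N$ matrix $Q$ with rows $q_1,\dots,q_m$ if $\|\ell_t\|_2\le\gamma$ for all $1\le t\le m$. *Column arrival model.* The columns $a_1,a_2,\dots\in\mathbb{R}^m$ of a matrix arrive one at a time. A (deterministic) online factorization algorithm fixes an initial, possibly empty, matrix $L_0$ with $m$ rows. When $a_t$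 arrives, it forms $L_t$ by adding (zero or more) columns to $L_{t-1}$ and outputs a column vector $r_t$ with $L_tr_t=a_t$ and $\|r_t\|_2\le1$; both may depend only on $a_1,\dots,a_t$ (and on $m$), in particular not on the total number of columns. The algorithm achieves value $\gamma$ on an $m\times N$ matrix $A$ with columns $a_1,\dots,a_N$ if $\|L_N\|_{2\to\infty}\le\gamma$. 1. For every $c>0$ there are a constant $K_c>0$, depending only on $c$, and an online factorization algorithm in the row arrival model such that, for all $m,N$ and every nonzero real $m\times N$ matrix $Q$ with rows $q_1,\dots,q_m$, the algorithm achieves value $$K_c\,\gamma_2(Q)\,\Bigl(1+\log\frac{\gamma_2(Q)}{\|q_s\|_\infty}\Bigr)^{\frac12+c}\,(1+\log N)^3,$$ where $q_s$ is the first nonzero row of $Q$ (so $s=1$ if $q_1\neq0$); on $Q=0$ it achieves value $0$. 2. There are an absolute constant $K>0$ and an online factorization algorithm in the column arrival model such that, for all $m,N$ and every real $m\times N$ matrix $A$, the algorithm achieves value $$K\,\gamma_2(A)\,(1+\log m)^3,$$ where $\log 0$ is read as $0$ if $m=0$. -/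

import Mathlib

noncomputable section

namespace OnlineFactorization

/-- The Euclidean norm of a finite real vector. -/
def l2norm {ι : Type*} [Fintype ι] (v : ι → ℝ) : ℝ :=
  ‖WithLp.toLp 2 v‖

/-- `‖R‖_{1→2}`: the largest Euclidean norm of a column of `R` (`0` if there are no columns). -/
def norm1to2 {k n : ℕ} (R : Matrix (Fin k) (Fin n) ℝ) : ℝ :=
  ⨆ j : Fin n, l2norm (fun i => R i j)

/-- `‖L‖_{2→∞}`: the largest Euclidean norm of a row of `L` (`0` if there are no rows). -/
def norm2toInf {m k : ℕ} (L : Matrix (Fin m) (Fin k) ℝ) : ℝ :=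
  ⨆ i : Fin m, l2norm (fun j => L i j)

/-- The factorization norm `γ₂(A)`: the least value of `‖L‖_{2→∞} ‖R‖_{1→2}` over all
factorizations `A = L R` through an arbitrary inner dimension `k`. -/
def gamma2 {m n : ℕ} (A : Matrix (Fin m) (Fin n) ℝ) : ℝ :=
  sInf {x : ℝ | ∃ (k : ℕ) (L : Matrix (Fin m) (Fin k) ℝ) (R : Matrix (Fin k) (Fin n) ℝ),
    L * R = A ∧ x = norm2toInf L * norm1to2 R}

/-- The first `t` rows of a matrix. -/
def firstRows {m n : ℕ} (Q : Matrix (Fin m) (Fin n) ℝ) (t : ℕ) (ht : t ≤ m) :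
    Matrix (Fin t) (Fin n) ℝ :=
  Q.submatrix (Fin.castLE ht) id

/-- The first `t` columns of a matrix. -/
def firstCols {m n : ℕ} (A : Matrix (Fin m) (Fin n) ℝ) (t : ℕ) (ht : t ≤ n) :
    Matrix (Fin m) (Fin t) ℝ :=
  A.submatrix id (Fin.castLE ht)

/-- A deterministic online factorization algorithm in the row arrival model, for rows in `ℝ^N`.

Everything the algorithm outputs at time `t` is a function of the matrix `Q_t` of the first `t`
rows only; the total number of rows is never part of the input.  The requirements hold for every
sequence of rows that may arrive. -/
structure RowArrivalAlgorithm (N : ℕ) where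
  /-- The number of rows of `R_t`, after the rows of `Q_t` have arrived. -/
  k : {t : ℕ} → Matrix (Fin t) (Fin N) ℝ → ℕ
  /-- The right matrix `R_t`; for `t = 0` this is the initial matrix `R_0`. -/
  R : {t : ℕ} → (Q : Matrix (Fin t) (Fin N) ℝ) → Matrix (Fin (k Q)) (Fin N) ℝ
  /-- The row vector `ℓ_{t+1}` that is output when row `t + 1` arrives. -/
  ell : {t : ℕ} → (Q : Matrix (Fin (t + 1)) (Fin N) ℝ) → Fin (k Q) → ℝ
  /-- Rows are only ever added to the right matrix. -/
  k_mono : ∀ {t : ℕ} (Q : Matrix (Fin (t + 1)) (Fin N) ℝ),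
    k (firstRows Q t t.le_succ) ≤ k Q
  /-- The rows that are already present in the right matrix never change. -/
  R_extends : ∀ {t : ℕ} (Q : Matrix (Fin (t + 1)) (Fin N) ℝ)
    (i : Fin (k (firstRows Q t t.le_succ))),
    R Q (Fin.castLE (k_mono Q) i) = R (firstRows Q t t.le_succ) i
  /-- `ℓ_t R_t = q_t`. -/
  ell_mul_R : ∀ {t : ℕ} (Q : Matrix (Fin (t + 1)) (Fin N) ℝ),
    Matrix.vecMul (ell Q) (R Q) = Q (Fin.last t)
  /-- `‖R_t‖_{1→2} ≤ 1`. -/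
  norm_R_le : ∀ {t : ℕ} (Q : Matrix (Fin t) (Fin N) ℝ), norm1to2 (R Q) ≤ 1

/-- The algorithm achieves factorization value `γ` on `Q`: `‖ℓ_t‖₂ ≤ γ` for `t = 1, …, m`. -/
def RowArrivalAlgorithm.AchievesValue {N m : ℕ} (alg : RowArrivalAlgorithm N)
    (Q : Matrix (Fin m) (Fin N) ℝ) (γ : ℝ) : Prop :=
  ∀ (t : ℕ) (ht : t + 1 ≤ m), l2norm (alg.ell (firstRows Q (t + 1) ht)) ≤ γ

/-- A deterministic online factorization algorithm in the column arrival model, for columns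
in `ℝ^m`.

Everything the algorithm outputs at time `t` is a function of the matrix `A_t` of the first `t`
columns only; the total number of columns is never part of the input.  The requirements hold for
every sequence of columns that may arrive. -/
structure ColumnArrivalAlgorithm (m : ℕ) where
  /-- The number of columns of `L_t`, after the columns of `A_t` have arrived. -/
  k : {t : ℕ} → Matrix (Fin m) (Fin t) ℝ → ℕ
  /-- The left matrix `L_t`; for `t = 0` this is the initial matrix `L_0`. -/
  L : {t : ℕ} → (A : Matrix (Fin m) (Fin t) ℝ) → Matrix (Fin m) (Fin (k A)) ℝ
  /-- The column vector `r_{t+1}` that is output when column `t + 1` arrives. -/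
  r : {t : ℕ} → (A : Matrix (Fin m) (Fin (t + 1)) ℝ) → Fin (k A) → ℝ
  /-- Columns are only ever added to the left matrix. -/
  k_mono : ∀ {t : ℕ} (A : Matrix (Fin m) (Fin (t + 1)) ℝ),
    k (firstCols A t t.le_succ) ≤ k A
  /-- The columns that are already present in the left matrix never change. -/
  L_extends : ∀ {t : ℕ} (A : Matrix (Fin m) (Fin (t + 1)) ℝ) (i : Fin m)
    (j : Fin (k (firstCols A t t.le_succ))),
    L A i (Fin.castLE (k_mono A) j) = L (firstCols A t t.le_succ) i j
  /-- `L_t r_t = a_t`. -/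
  L_mul_r : ∀ {t : ℕ} (A : Matrix (Fin m) (Fin (t + 1)) ℝ),
    Matrix.mulVec (L A) (r A) = fun i => A i (Fin.last t)
  /-- `‖r_t‖₂ ≤ 1` for every `t`, that is, `‖R_t‖_{1→2} ≤ 1`, where the columns of `R_t` are
  `r_1, …, r_t` padded with zeros. -/
  norm_r_le : ∀ {t : ℕ} (A : Matrix (Fin m) (Fin (t + 1)) ℝ), l2norm (r A) ≤ 1

/-- The algorithm achieves factorization value `γ` on `A`: the final left matrix satisfies
`‖L_N‖_{2→∞} ≤ γ`. -/
def ColumnArrivalAlgorithm.AchievesValue {m N : ℕ} (alg : ColumnArrivalAlgorithm m)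
    (A : Matrix (Fin m) (Fin N) ℝ) (γ : ℝ) : Prop :=
  norm2toInf (alg.L A) ≤ γ

end OnlineFactorization

end

/-! An online factorization amounts to a Loewner-increasing family of matrices `S`. Appending the
square root of each increment to a factor `F` keeps `Fᵀ F = S`, and the coefficients `F S⁻¹ q`
reproduce the arrival `q` with squared norm `qᵀ S⁻¹ q`. The task is therefore to keep the diagonal
of `S` small while `qᵀ S⁻¹ q` stays bounded for every arrival. Transposition makes this serve both
models.

At a known scale `g > γ₂`, an offline factorization yields a matrix `X` with `1 ≤ X`, diagonal at
most 2 and `aᵀ X⁻¹ a ≤ 1` for all scaled rows `a = q / g`. The online procedure does not know `X`; a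
primal-dual argument with exponential weights compares it to `X`. Let `P` be diagonal with weights
exponential in the diagonal of `S`, let `M` be `1` plus the weighted sum of the `a aᵀ`, and let `G`
be the geometric mean of `M` and `P⁻¹`, that is, `G P G = M`. While `a` is uncovered, a little
weight `w` is put on `a aᵀ`, and `S` grows by the change of `G` with `P` frozen. Since `G` decreases
in `P`, the relation `G ≤ S` survives the later reweighting.

Each update raises the fidelity `tr (P G)` by at least `w / 3` and raises `tr P` by at most 1/14 of
the fidelity gain (`CoverState.inv_update`). Conversely the variational bound `two_mul_trace_le`,
tested on `3 X`, gives `tr (P G) ≤ 7 tr P`. Hence `tr P ≤ 2 n`: the total weight is `O(n)`, so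
boundedly many updates cover an arrival, and by the exponential weights the diagonal of `S` is `O(1
+ log n)`.

As `γ₂` is not known in advance, the procedure is run at all scales `2 ^ j * β`, with `β` the sup
norm of the first nonzero row, and the results up to the current scale are added with weights `ω`.
For columns `ω` is the squared scale, whose sum is geometric. For rows `ω` must be summable over all
`j`; the choice `(j + 1) ^ -(1 + 2c)` costs the logarithm to the power `1/2 + c`. -/

noncomputable section

namespace OnlineFactorization

open Matrix
open scoped MatrixOrder

/-! ### Loewner order inequalities and the equation `G P G = M` -/

section MatrixInequalities

variable {n : Type*} [Fintype n]

theorem posSemidef_of_quadForm {A : Matrix n n ℝ} (hA : A.IsHermitian)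
    (h : ∀ x, 0 ≤ x ⬝ᵥ A *ᵥ x) : A.PosSemidef :=
  .of_dotProduct_mulVec_nonneg hA fun x => by simpa using h x

theorem quadForm_nonneg {A : Matrix n n ℝ} (hA : A.PosSemidef) (x : n → ℝ) :
    0 ≤ x ⬝ᵥ A *ᵥ x := by
  simpa using hA.dotProduct_mulVec_nonneg x

theorem quadForm_mono {A B : Matrix n n ℝ} (h : A ≤ B) (x : n → ℝ) :
    x ⬝ᵥ A *ᵥ x ≤ x ⬝ᵥ B *ᵥ x := by
  have := quadForm_nonneg (Matrix.le_iff.1 h) x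
  rw [sub_mulVec, dotProduct_sub] at this
  linarith

theorem diag_mono {ι : Type*} {A B : Matrix ι ι ℝ} (h : A ≤ B) (i : ι) : A i i ≤ B i i := by
  have := (Matrix.le_iff.1 h).diag_nonneg (i := i)
  rw [Matrix.sub_apply] at this
  linarith

theorem dotProduct_mulVec_comm {A : Matrix n n ℝ} (hA : A.IsHermitian) (x y : n → ℝ) :
    x ⬝ᵥ A *ᵥ y = y ⬝ᵥ A *ᵥ x := by
  rw [dotProduct_mulVec, ← mulVec_transpose, dotProduct_comm]
  rw [← conjTranspose_eq_transpose_of_trivial, hA.eq]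

theorem posDef_of_le {ι : Type*} {A B : Matrix ι ι ℝ} (hA : A.PosDef) (h : A ≤ B) : B.PosDef := by
  simpa using hA.add_posSemidef (Matrix.le_iff.1 h)

theorem quadForm_vecMulVec (a x : n → ℝ) :
    x ⬝ᵥ (vecMulVec a a) *ᵥ x = (a ⬝ᵥ x) ^ 2 := by
  rw [vecMulVec_mulVec]
  simp [dotProduct_comm x a, sq]

theorem isHermitian_vecMulVec (a : n → ℝ) : (vecMulVec a a).IsHermitian := by
  simpa using (posSemidef_vecMulVec_self_star a).isHermitian

theorem trace_vecMulVec_mul (a : n → ℝ) (B : Matrix n n ℝ) :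
    (vecMulVec a a * B).trace = a ⬝ᵥ B *ᵥ a := by
  rw [trace_mul_comm, mul_vecMulVec, trace_vecMulVec, dotProduct_comm]

variable [DecidableEq n]

/-- The square root is operator monotone. -/
theorem le_of_mul_self_le {A B : Matrix n n ℝ} (hA : A.PosSemidef) (hB : B.PosDef)
    (h : A * A ≤ B * B) : A ≤ B := by
  have hH : (B - A).IsHermitian := hB.isHermitian.sub hA.isHermitian
  rw [Matrix.le_iff, hH.posSemidef_iff_eigenvalues_nonneg]
  intro i
  set v : n → ℝ := ⇑(hH.eigenvectorBasis i) with hv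
  set l := hH.eigenvalues i
  have hv0 : v ≠ 0 := by
    intro h0
    have := hH.eigenvectorBasis.orthonormal.ne_zero i
    apply this
    ext j
    exact congrFun h0 j
  have he : (B - A) *ᵥ v = l • v := hH.mulVec_eigenvectorBasis i
  have h1 : ∀ C : Matrix n n ℝ, C.IsHermitian → v ⬝ᵥ (C * C) *ᵥ v = (C *ᵥ v) ⬝ᵥ (C *ᵥ v) := by
    intro C hC
    rw [← mulVec_mulVec, dotProduct_mulVec_comm hC]
  have h2 := quadForm_mono h v
  rw [h1 A hA.isHermitian, h1 B hB.isHermitian] at h2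
  have hBv : B *ᵥ v = A *ᵥ v + l • v := by rw [← he, sub_mulVec]; abel
  -- On an eigenvector of `B - A` the difference of squares factors, so a negative eigenvalue `l`
  -- would contradict `A² ≤ B²`.
  have h3 : (B *ᵥ v) ⬝ᵥ (B *ᵥ v) - (A *ᵥ v) ⬝ᵥ (A *ᵥ v)
      = l * (v ⬝ᵥ B *ᵥ v + v ⬝ᵥ A *ᵥ v) := by
    rw [hBv]
    simp only [add_dotProduct, dotProduct_add, smul_dotProduct, dotProduct_smul, smul_eq_mul,
      dotProduct_comm (A *ᵥ v) v]
    ring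
  have h4 : 0 < v ⬝ᵥ B *ᵥ v := by simpa using hB.dotProduct_mulVec_pos hv0
  have h5 := quadForm_nonneg hA v
  by_contra hl
  have hl' : l < 0 := not_le.1 hl
  nlinarith

theorem exists_posDef_sqrt {P : Matrix n n ℝ} (hP : P.PosDef) :
    ∃ D : Matrix n n ℝ, D.PosDef ∧ D * D = P := by
  have h0 : (CFC.sqrt P).PosSemidef := (CFC.sqrt_nonneg P).posSemidef
  have h1 : CFC.sqrt P * CFC.sqrt P = P := CFC.sqrt_mul_sqrt_self P hP.posSemidef.nonneg
  refine ⟨CFC.sqrt P, ?_, h1⟩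
  rw [h0.posDef_iff_isUnit]
  have hu := hP.isUnit
  rw [← h1] at hu
  exact isUnit_of_mul_isUnit_left hu

theorem PosDef.mul_inv_self {A : Matrix n n ℝ} (hA : A.PosDef) : A * A⁻¹ = 1 :=
  Matrix.mul_nonsing_inv _ ((Matrix.isUnit_iff_isUnit_det A).1 hA.isUnit)

theorem PosDef.inv_mul_self {A : Matrix n n ℝ} (hA : A.PosDef) : A⁻¹ * A = 1 :=
  Matrix.nonsing_inv_mul _ ((Matrix.isUnit_iff_isUnit_det A).1 hA.isUnit)

theorem mul_mul_le_mul_mul {A B : Matrix n n ℝ} (h : A ≤ B) {C : Matrix n n ℝ}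
    (hC : C.IsHermitian) : C * A * C ≤ C * B * C := by
  have := (Matrix.le_iff.1 h).conjTranspose_mul_mul_same C
  rw [hC.eq] at this
  rw [Matrix.le_iff]
  convert this using 1
  noncomm_ring

/-- Uniqueness and monotonicity of the solution of `G P G = M`. -/
theorem le_of_mul_mul_le {P G H : Matrix n n ℝ} (hP : P.PosDef) (hG : G.PosSemidef)
    (hH : H.PosDef) (h : G * P * G ≤ H * P * H) : G ≤ H := by
  obtain ⟨D, hD, rfl⟩ := exists_posDef_sqrt hP
  have hDh := hD.isHermitian
  have hconj : ∀ X : Matrix n n ℝ, D⁻¹ * (D * X * D) * D⁻¹ = X := by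
    intro X
    calc D⁻¹ * (D * X * D) * D⁻¹ = (D⁻¹ * D) * X * (D * D⁻¹) := by noncomm_ring
      _ = X := by rw [PosDef.mul_inv_self hD, PosDef.inv_mul_self hD]; simp
  -- With `P = D²`, conjugating by `D` turns the hypothesis into `(D G D)² ≤ (D H D)²`.
  have hA : (D * G * D).PosSemidef := by
    have := hG.conjTranspose_mul_mul_same D
    rwa [hDh.eq] at this
  have hB : (D * H * D).PosDef := by
    have := (Matrix.IsUnit.posDef_star_left_conjugate_iff (x := H) hD.isUnit).2 hH
    rwa [star_eq_conjTranspose, hDh.eq] at this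
  have h1 : (D * G * D) * (D * G * D) ≤ (D * H * D) * (D * H * D) := by
    have := mul_mul_le_mul_mul h hDh
    convert this using 1 <;> noncomm_ring
  have h2 := mul_mul_le_mul_mul (le_of_mul_self_le hA hB h1) hD.inv.isHermitian
  rwa [hconj, hconj] at h2

/-- With `P = D²`, the solution is `D⁻¹ (D M D)^(1/2) D⁻¹`. -/
theorem exists_geoMean {P M : Matrix n n ℝ} (hP : P.PosDef) (hM : M.PosDef) :
    ∃ G : Matrix n n ℝ, G.PosDef ∧ G * P * G = M := by
  obtain ⟨D, hD, rfl⟩ := exists_posDef_sqrt hP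
  have hDh := hD.isHermitian
  have hB : (D * M * D).PosDef := by
    have := (Matrix.IsUnit.posDef_star_left_conjugate_iff (x := M) hD.isUnit).2 hM
    rwa [star_eq_conjTranspose, hDh.eq] at this
  obtain ⟨T, hT, hTT⟩ := exists_posDef_sqrt hB
  refine ⟨D⁻¹ * T * D⁻¹, ?_, ?_⟩
  · have := (Matrix.IsUnit.posDef_star_left_conjugate_iff (x := T) hD.inv.isUnit).2 hT
    rwa [star_eq_conjTranspose, hD.inv.isHermitian.eq] at this
  · calc D⁻¹ * T * D⁻¹ * (D * D) * (D⁻¹ * T * D⁻¹)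
        = D⁻¹ * T * (D⁻¹ * D) * (D * D⁻¹) * T * D⁻¹ := by noncomm_ring
      _ = D⁻¹ * (T * T) * D⁻¹ := by
        rw [PosDef.mul_inv_self hD, PosDef.inv_mul_self hD]; noncomm_ring
      _ = (D⁻¹ * D) * M * (D * D⁻¹) := by rw [hTT]; noncomm_ring
      _ = M := by rw [PosDef.mul_inv_self hD, PosDef.inv_mul_self hD]; simp

theorem trace_mul_nonneg {A B : Matrix n n ℝ} (hA : A.PosSemidef) (hB : B.PosSemidef) :
    0 ≤ (A * B).trace := by
  obtain ⟨C, rfl⟩ := CStarAlgebra.nonneg_iff_eq_star_mul_self.mp hA.nonneg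
  rw [star_eq_conjTranspose, trace_mul_comm, ← Matrix.mul_assoc, trace_mul_comm,
    ← Matrix.mul_assoc]
  exact (hB.mul_mul_conjTranspose_same C).trace_nonneg

theorem trace_mul_mono {P A B : Matrix n n ℝ} (hP : P.PosSemidef) (h : A ≤ B) :
    (P * A).trace ≤ (P * B).trace := by
  have := trace_mul_nonneg hP (Matrix.le_iff.1 h)
  rw [Matrix.mul_sub, trace_sub] at this
  linarith

/-- The variational upper bound for the fidelity `tr (P G)` of `P` and `M = G P G`. -/
theorem two_mul_trace_le {P G X : Matrix n n ℝ} (hP : P.PosSemidef) (hG : G.IsHermitian)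
    (hX : X.PosDef) : 2 * (P * G).trace ≤ (P * X).trace + (G * P * G * X⁻¹).trace := by
  -- The bound is the expansion of `tr (P (X - G) X⁻¹ (X - G)) ≥ 0`; equality holds at `X = G`.
  have h1 : ((X - G) * X⁻¹ * (X - G)).PosSemidef := by
    have := hX.inv.posSemidef.conjTranspose_mul_mul_same (X - G)
    rwa [(hX.isHermitian.sub hG).eq] at this
  have h2 := trace_mul_nonneg hP h1
  have h3 : (X - G) * X⁻¹ * (X - G) = X - G - G + G * X⁻¹ * G := by
    calc (X - G) * X⁻¹ * (X - G)
        = (X * X⁻¹) * X - X * X⁻¹ * G - G * (X⁻¹ * X) + G * X⁻¹ * G := by noncomm_ring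
      _ = _ := by rw [PosDef.mul_inv_self hX, PosDef.inv_mul_self hX]; simp
  have h4 : (G * P * G * X⁻¹).trace = (P * (G * X⁻¹ * G)).trace := by
    rw [show G * P * G * X⁻¹ = G * (P * G * X⁻¹) by noncomm_ring, trace_mul_comm]
    congr 1
    noncomm_ring
  rw [h3, Matrix.mul_add, Matrix.mul_sub, Matrix.mul_sub, trace_add, trace_sub, trace_sub,
    ← h4] at h2
  linarith

/-- By completing the square, `qᵀ A⁻¹ q` is the maximum of `2 q·y - yᵀ A y`; take `y = B⁻¹ q`. -/
theorem inv_quadForm_anti {A B : Matrix n n ℝ} (hA : A.PosDef) (h : A ≤ B) (q : n → ℝ) :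
    q ⬝ᵥ B⁻¹ *ᵥ q ≤ q ⬝ᵥ A⁻¹ *ᵥ q := by
  have hB := posDef_of_le hA h
  set x := A⁻¹ *ᵥ q
  set y := B⁻¹ *ᵥ q
  have hx : A *ᵥ x = q := by simp [x, PosDef.mul_inv_self hA]
  have hy : B *ᵥ y = q := by simp [y, PosDef.mul_inv_self hB]
  have h1 := quadForm_nonneg hA.posSemidef (x - y)
  have h2 := quadForm_mono h y
  rw [mulVec_sub, dotProduct_sub, sub_dotProduct, sub_dotProduct, hx,
    dotProduct_mulVec_comm hA.isHermitian x y, hx] at h1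
  rw [hy] at h2
  simp only [dotProduct_comm q]
  linarith

/-- Cauchy–Schwarz for the inner product of `S`, read off from the discriminant of a nonnegative
quadratic. -/
theorem sq_dotProduct_le {S : Matrix n n ℝ} (hS : S.PosDef) (a x : n → ℝ) :
    (a ⬝ᵥ x) ^ 2 ≤ (a ⬝ᵥ S⁻¹ *ᵥ a) * (x ⬝ᵥ S *ᵥ x) := by
  set y := S⁻¹ *ᵥ a
  have hy : S *ᵥ y = a := by simp [y, PosDef.mul_inv_self hS]
  have key : ∀ t : ℝ, 0 ≤ (x ⬝ᵥ S *ᵥ x) * (t * t) + (-2 * (a ⬝ᵥ x)) * t + a ⬝ᵥ y := by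
    intro t
    have h1 := quadForm_nonneg hS.posSemidef (t • x - y)
    rw [mulVec_sub, dotProduct_sub, sub_dotProduct, sub_dotProduct, hy, mulVec_smul,
      dotProduct_smul, smul_dotProduct, smul_dotProduct, dotProduct_smul,
      dotProduct_mulVec_comm hS.isHermitian y x, hy, dotProduct_comm x a,
      dotProduct_comm y a] at h1
    simp only [smul_eq_mul] at h1
    linarith
  have := discrim_le_zero key
  rw [discrim] at this
  nlinarith

theorem vecMulVec_le {S : Matrix n n ℝ} (hS : S.PosDef) (a : n → ℝ) :
    vecMulVec a a ≤ (a ⬝ᵥ S⁻¹ *ᵥ a) • S := by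
  rw [Matrix.le_iff]
  refine posSemidef_of_quadForm ?_ fun x => ?_
  · exact (hS.posSemidef.smul (quadForm_nonneg hS.inv.posSemidef a)).isHermitian.sub
      (isHermitian_vecMulVec a)
  · rw [sub_mulVec, dotProduct_sub, quadForm_vecMulVec, smul_mulVec, dotProduct_smul, smul_eq_mul]
    linarith [sq_dotProduct_le hS a x]

/-- A rank one update of `M = G P G` moves `G` by at most a multiple of `P⁻¹`. -/
theorem le_add_smul_inv {P G H : Matrix n n ℝ} (hP : P.PosDef) (hG : G.PosDef) (hH : H.PosDef)
    {w s : ℝ} (hw : 0 ≤ w) (hs : 0 ≤ s) {a : n → ℝ} (hws : w * (a ⬝ᵥ P *ᵥ a) ≤ s ^ 2)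
    (h : H * P * H = G * P * G + w • vecMulVec a a) : H ≤ G + s • P⁻¹ := by
  have hX : (G + s • P⁻¹).PosDef := hG.add_posSemidef (hP.inv.posSemidef.smul hs)
  refine le_of_mul_mul_le hP hH.posSemidef hX ?_
  -- The term `s² P⁻¹` alone dominates the rank one update; the cross terms `2 s G` are discarded.
  have e : (G + s • P⁻¹) * P * (G + s • P⁻¹) = G * P * G + (s • G + s • G + s ^ 2 • P⁻¹) := by
    have e1 : P⁻¹ * P = 1 := PosDef.inv_mul_self hP
    have e2 : P * P⁻¹ = 1 := PosDef.mul_inv_self hP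
    simp only [add_mul, mul_add, Matrix.smul_mul, Matrix.mul_smul, e1, Matrix.mul_assoc, e2,
      Matrix.mul_one, Matrix.one_mul]
    rw [smul_smul, ← sq]
    abel
  rw [h, e]
  gcongr
  have h1 := vecMulVec_le hP.inv a
  rw [Matrix.nonsing_inv_nonsing_inv _ ((Matrix.isUnit_iff_isUnit_det P).1 hP.isUnit)] at h1
  have h2 : w • vecMulVec a a ≤ s ^ 2 • P⁻¹ := by
    have h3 := (Matrix.le_iff.1 h1).smul hw
    have h4 := hP.inv.posSemidef.smul (sub_nonneg.2 hws)
    rw [Matrix.le_iff]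
    convert h3.add h4 using 1
    rw [smul_sub, smul_smul, sub_smul]
    abel
  refine h2.trans ?_
  rw [Matrix.le_iff, add_sub_cancel_right]
  exact (hG.posSemidef.smul hs).add (hG.posSemidef.smul hs)

end MatrixInequalities

/-! ### The online covering procedure at a fixed scale -/

section CoverState

variable {n : ℕ}

/-- The solution `G` of `G P G = M`, i.e. the geometric mean of `M` and `P⁻¹`, for positive
definite `P` and `M`. -/
def geoMean (P M : Matrix (Fin n) (Fin n) ℝ) : Matrix (Fin n) (Fin n) ℝ :=
  open Classical in if h : P.PosDef ∧ M.PosDef then (exists_geoMean h.1 h.2).choose else 0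

theorem geoMean_posDef {P M : Matrix (Fin n) (Fin n) ℝ} (hP : P.PosDef) (hM : M.PosDef) :
    (geoMean P M).PosDef := by
  rw [geoMean, dif_pos ⟨hP, hM⟩]
  exact (exists_geoMean hP hM).choose_spec.1

theorem geoMean_mul_mul {P M : Matrix (Fin n) (Fin n) ℝ} (hP : P.PosDef) (hM : M.PosDef) :
    geoMean P M * P * geoMean P M = M := by
  rw [geoMean, dif_pos ⟨hP, hM⟩]
  exact (exists_geoMean hP hM).choose_spec.2

theorem geoMean_mono {P M M' : Matrix (Fin n) (Fin n) ℝ} (hP : P.PosDef) (hM : M.PosDef)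
    (h : M ≤ M') : geoMean P M ≤ geoMean P M' := by
  have hM' := posDef_of_le hM h
  refine le_of_mul_mul_le hP (geoMean_posDef hP hM).posSemidef (geoMean_posDef hP hM') ?_
  rwa [geoMean_mul_mul hP hM, geoMean_mul_mul hP hM']

/-- With `G'` the mean for `P'`, one has `G' P G' ≤ G' P' G' = M = G P G`, and `le_of_mul_mul_le`
applies. -/
theorem geoMean_anti {P P' M : Matrix (Fin n) (Fin n) ℝ} (hP : P.PosDef) (hM : M.PosDef)
    (h : P ≤ P') : geoMean P' M ≤ geoMean P M := by
  have hP' := posDef_of_le hP h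
  have hG' := geoMean_posDef hP' hM
  refine le_of_mul_mul_le hP hG'.posSemidef (geoMean_posDef hP hM) ?_
  rw [geoMean_mul_mul hP hM]
  conv_rhs => rw [← geoMean_mul_mul hP' hM]
  exact mul_mul_le_mul_mul h hG'.isHermitian

/-- The fidelity is monotone in its first argument. -/
theorem trace_mul_geoMean_mono {P P' M : Matrix (Fin n) (Fin n) ℝ} (hP : P.PosDef)
    (hM : M.PosDef) (h : P ≤ P') :
    (P * geoMean P M).trace ≤ (P' * geoMean P' M).trace := by
  have hP' := posDef_of_le hP h
  have hG' := geoMean_posDef hP' hM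
  -- Testing with the new mean `G'` is useful because `tr (M G'⁻¹)` equals the new fidelity `tr (P'
  -- G')`.
  have h1 := two_mul_trace_le hP.posSemidef (geoMean_posDef hP hM).isHermitian hG'
  rw [geoMean_mul_mul hP hM] at h1
  have h2 : (M * (geoMean P' M)⁻¹).trace = (P' * geoMean P' M).trace := by
    have e := congrArg (fun B => (B * (geoMean P' M)⁻¹).trace) (geoMean_mul_mul hP' hM)
    rw [← e]
    rw [Matrix.mul_assoc, PosDef.mul_inv_self hG', Matrix.mul_one, trace_mul_comm]
  have h3 := trace_mul_mono hG'.posSemidef h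
  rw [trace_mul_comm, trace_mul_comm _ P'] at h3
  linarith

/-- The increase of the fidelity under a rank one update. -/
theorem trace_mul_geoMean_add {P M : Matrix (Fin n) (Fin n) ℝ} (hP : P.PosDef)
    (hM : M.PosDef) {w : ℝ} {a : Fin n → ℝ} (hM' : (M + w • vecMulVec a a).PosDef) :
    2 * (P * geoMean P M).trace +
        w * (a ⬝ᵥ (geoMean P (M + w • vecMulVec a a))⁻¹ *ᵥ a) ≤
      2 * (P * geoMean P (M + w • vecMulVec a a)).trace := by
  set G' := geoMean P (M + w • vecMulVec a a) with hG'def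
  have hG' : G'.PosDef := geoMean_posDef hP hM'
  have h1 := two_mul_trace_le hP.posSemidef (geoMean_posDef hP hM).isHermitian hG'
  rw [geoMean_mul_mul hP hM] at h1
  have h2 : ((M + w • vecMulVec a a) * G'⁻¹).trace = (P * G').trace := by
    conv_lhs => rw [← geoMean_mul_mul hP hM']
    rw [Matrix.mul_assoc, PosDef.mul_inv_self hG', Matrix.mul_one, trace_mul_comm]
  rw [Matrix.add_mul, Matrix.smul_mul, trace_add, trace_smul, trace_vecMulVec_mul,
    smul_eq_mul] at h2
  linarith

/-- The multiplicative weight of each coordinate. -/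
def expWeight (S : Matrix (Fin n) (Fin n) ℝ) (i : Fin n) : ℝ :=
  Real.exp ((S i i - 1) / 28)

/-- The diagonal matrix of the multiplicative weights. -/
def weightMatrix (S : Matrix (Fin n) (Fin n) ℝ) : Matrix (Fin n) (Fin n) ℝ :=
  diagonal (expWeight S)

theorem weightMatrix_posDef (S : Matrix (Fin n) (Fin n) ℝ) : (weightMatrix S).PosDef :=
  PosDef.diagonal fun _ => Real.exp_pos _

theorem weightMatrix_mono {S S' : Matrix (Fin n) (Fin n) ℝ} (h : S ≤ S') :
    weightMatrix S ≤ weightMatrix S' := by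
  rw [Matrix.le_iff, weightMatrix, weightMatrix, diagonal_sub, posSemidef_diagonal_iff]
  intro i
  have := diag_mono h i
  exact sub_nonneg.2 (Real.exp_le_exp.2 (by linarith))

theorem trace_weightMatrix_mul (S B : Matrix (Fin n) (Fin n) ℝ) :
    (weightMatrix S * B).trace = ∑ i, expWeight S i * B i i := by
  simp [weightMatrix, trace, diagonal_mul]

variable (n) in
/-- The state of the online covering procedure: the matrix `M` of weighted arrivals, the total
weight `W`, and the current covering matrix `S`. -/
structure CoverState where
  M : Matrix (Fin n) (Fin n) ℝ
  S : Matrix (Fin n) (Fin n) ℝ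
  W : ℝ

namespace CoverState

variable (n) in
/-- The initial state. -/
def start : CoverState n := ⟨1, 1, 0⟩

variable (n) in
/-- The weight added in a single step. -/
def stepWeight : ℝ := 1 / (16 * ((n : ℝ) + 1))

/-- The geometric mean of the current `M` and the inverse of the current weights. -/
def mean (st : CoverState n) : Matrix (Fin n) (Fin n) ℝ := geoMean (weightMatrix st.S) st.M

/-- The fidelity potential. -/
def potential (st : CoverState n) : ℝ := (weightMatrix st.S * st.mean).trace

/-- Add weight to `a`. -/
def update (a : Fin n → ℝ) (st : CoverState n) : CoverState n where
  M := st.M + stepWeight n • vecMulVec a a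
  -- Both means use the old weights. Then the increment is positive semidefinite and its weighted
  -- trace is exactly the fidelity gain before reweighting.
  S := st.S + (geoMean (weightMatrix st.S) (st.M + stepWeight n • vecMulVec a a) - st.mean)
  W := st.W + stepWeight n

open Classical in
/-- Add weight to `a` unless `a` is covered already. -/
def step (a : Fin n → ℝ) (st : CoverState n) : CoverState n :=
  if a ⬝ᵥ st.S⁻¹ *ᵥ a ≤ 1 then st else update a st

variable (n) in
/-- The number of steps after which an arrival is certainly covered. -/
def numSteps : ℕ := 700 * (n + 1) ^ 2

/-- Treat the arrival of `a`. -/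
def absorb (a : Fin n → ℝ) (st : CoverState n) : CoverState n :=
  (step a)^[numSteps n] st

end CoverState

/-- An offline covering matrix that the procedure is compared to. -/
structure IsReference (X : Matrix (Fin n) (Fin n) ℝ) : Prop where
  one_le : 1 ≤ X
  diag_le : ∀ i, X i i ≤ 2

theorem IsReference.posDef {X : Matrix (Fin n) (Fin n) ℝ} (hX : IsReference X) : X.PosDef :=
  posDef_of_le .one hX.one_le

namespace CoverState

/-- The invariant of the covering procedure with respect to the reference `X`. -/
structure Inv (X : Matrix (Fin n) (Fin n) ℝ) (st : CoverState n) : Prop where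
  posDef_M : st.M.PosDef
  one_le_S : 1 ≤ st.S
  mean_le_S : st.mean ≤ st.S
  W_nonneg : 0 ≤ st.W
  trace_le : (st.M * X⁻¹).trace ≤ n + st.W
  W_le : st.W ≤ 3 * st.potential
  sum_le : ∑ i, expWeight st.S i ≤ n + st.potential / 14

theorem stepWeight_pos : 0 < stepWeight n := by rw [stepWeight]; positivity

theorem weightMatrix_one : weightMatrix (1 : Matrix (Fin n) (Fin n) ℝ) = 1 := by
  simp [weightMatrix, expWeight, funext_iff, Pi.one_def]

theorem geoMean_one_one : geoMean (1 : Matrix (Fin n) (Fin n) ℝ) 1 = 1 := by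
  have h1 := geoMean_posDef (P := (1 : Matrix (Fin n) (Fin n) ℝ)) .one .one
  have h2 := geoMean_mul_mul (P := (1 : Matrix (Fin n) (Fin n) ℝ)) .one .one
  apply le_antisymm
  · exact le_of_mul_mul_le .one h1.posSemidef .one (by rw [h2]; simp)
  · exact le_of_mul_mul_le .one PosSemidef.one h1 (by rw [h2]; simp)

theorem inv_start {X : Matrix (Fin n) (Fin n) ℝ} (hX : IsReference X) : Inv X (start n) := by
  have hm : (start n).mean = 1 := by
    simp only [mean, start, weightMatrix_one, geoMean_one_one]
  have hp : (start n).potential = n := by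
    rw [potential, hm]
    simp [start, weightMatrix_one]
  refine ⟨.one, le_rfl, ?_, le_rfl, ?_, ?_, ?_⟩
  · rw [hm]; rfl
  · simp only [start, Matrix.one_mul, add_zero]
    rw [trace]
    calc ∑ i, X⁻¹.diag i ≤ ∑ i : Fin n, (1 : ℝ) := by
          refine Finset.sum_le_sum fun i _ => ?_
          have := inv_quadForm_anti .one hX.one_le (Pi.single i 1)
          simpa using this
      _ = n := by simp
  · rw [hp]; simp [start]
  · rw [hp]
    have : (0 : ℝ) ≤ n := by positivity
    simp [start, expWeight]
    positivity

variable {X : Matrix (Fin n) (Fin n) ℝ} {st : CoverState n}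

theorem Inv.posDef_S (h : Inv X st) : st.S.PosDef := posDef_of_le .one h.one_le_S

theorem Inv.one_le_expWeight (h : Inv X st) (i : Fin n) : 1 ≤ expWeight st.S i := by
  have := diag_mono h.one_le_S i
  rw [one_apply_eq] at this
  exact Real.one_le_exp (by linarith)

theorem Inv.card_le_sum (h : Inv X st) : (n : ℝ) ≤ ∑ i, expWeight st.S i := by
  calc (n : ℝ) = ∑ i : Fin n, (1 : ℝ) := by simp
    _ ≤ _ := Finset.sum_le_sum fun i _ => h.one_le_expWeight i

/-- Weak duality against `3 X`: twice the potential is at most `6 Σ + (n + W) / 3`, where `Σ` is the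
sum of the weights. The factor 3 makes `W / 3` absorbable into one copy of the potential, and `n ≤
Σ`. -/
theorem Inv.potential_le_sum (hX : IsReference X) (h : Inv X st) :
    st.potential ≤ 7 * ∑ i, expWeight st.S i := by
  have hP := weightMatrix_posDef st.S
  have h3 : ((3 : ℝ) • X).PosDef := hX.posDef.smul (by norm_num : (0 : ℝ) < 3)
  have h1 := two_mul_trace_le hP.posSemidef (geoMean_posDef hP h.posDef_M).isHermitian h3
  rw [geoMean_mul_mul hP h.posDef_M] at h1
  have hinv : ((3 : ℝ) • X)⁻¹ = (3 : ℝ)⁻¹ • X⁻¹ := by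
    apply Matrix.inv_eq_right_inv
    rw [Matrix.smul_mul, Matrix.mul_smul, smul_smul, PosDef.mul_inv_self hX.posDef]
    norm_num
  have h4 : (weightMatrix st.S * (3 : ℝ) • X).trace ≤ 6 * ∑ i, expWeight st.S i := by
    rw [trace_weightMatrix_mul, Finset.mul_sum]
    refine Finset.sum_le_sum fun i _ => ?_
    have := hX.diag_le i
    have hp := h.one_le_expWeight i
    simp only [Matrix.smul_apply, smul_eq_mul]
    nlinarith
  rw [hinv, Matrix.mul_smul st.M, trace_smul, smul_eq_mul] at h1
  have h5 := h.trace_le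
  have h6 := h.W_le
  have h7 := h.card_le_sum
  have h8 : st.potential = (weightMatrix st.S * geoMean (weightMatrix st.S) st.M).trace := rfl
  rw [← h8] at h1
  linarith

/-- The two bounds close up: `Σ ≤ n + (7 / 14) Σ`. -/
theorem Inv.sum_le_two_mul (hX : IsReference X) (h : Inv X st) :
    ∑ i, expWeight st.S i ≤ 2 * n := by
  linarith [h.potential_le_sum hX, h.sum_le]

theorem Inv.W_le_const (hX : IsReference X) (h : Inv X st) : st.W ≤ 42 * n := by
  linarith [h.potential_le_sum hX, h.sum_le_two_mul hX, h.W_le]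

theorem Inv.diag_S_le (hX : IsReference X) (h : Inv X st) (i : Fin n) :
    st.S i i ≤ 29 * (1 + Real.log n) := by
  have h1 : expWeight st.S i ≤ 2 * n :=
    (Finset.single_le_sum (f := expWeight st.S) (fun j _ => (Real.exp_pos _).le) (Finset.mem_univ i)).trans
      (h.sum_le_two_mul hX)
  have hn : (1 : ℝ) ≤ n := by exact_mod_cast Fin.pos i
  have h2 := Real.log_le_log (Real.exp_pos _) h1
  rw [Real.log_exp, Real.log_mul (by norm_num) (by positivity)] at h2
  have h3 : Real.log 2 ≤ 1 := by linarith [Real.log_two_lt_d9]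
  linarith [Real.log_nonneg hn]

theorem sq_apply_le {a : Fin n → ℝ} (hX : IsReference X) (ha : a ⬝ᵥ X⁻¹ *ᵥ a ≤ 1) (i : Fin n) :
    a i ^ 2 ≤ 2 := by
  have h1 := sq_dotProduct_le hX.posDef a (Pi.single i 1)
  simp only [dotProduct_single, mul_one, mulVec_single_one, single_dotProduct, one_mul,
    col_apply] at h1
  have h2 := quadForm_nonneg hX.posDef.inv.posSemidef a
  have h3 := hX.posDef.diag_pos (i := i)
  nlinarith [hX.diag_le i]

theorem posDef_update {a : Fin n → ℝ} (h : Inv X st) :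
    (st.M + stepWeight n • vecMulVec a a).PosDef := by
  refine h.posDef_M.add_posSemidef (PosSemidef.smul ?_ stepWeight_pos.le)
  simpa using posSemidef_vecMulVec_self_star a

theorem le_S_update {a : Fin n → ℝ} (h : Inv X st) : st.S ≤ (update a st).S := by
  have hP := weightMatrix_posDef st.S
  have : st.mean ≤ geoMean (weightMatrix st.S) (st.M + stepWeight n • vecMulVec a a) := by
    refine geoMean_mono hP h.posDef_M ?_
    rw [Matrix.le_iff, add_sub_cancel_left]
    refine PosSemidef.smul ?_ stepWeight_pos.le
    simpa using posSemidef_vecMulVec_self_star a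
  simpa [update] using this

/-- The steps are small: entries of `a` are bounded through `X` and the weights sum to at most `2
n`, so `aᵀ P a ≤ 4 n`, and the step weight of order `1 / n` gives `G' ≤ G + P⁻¹ / 2` with `P⁻¹ ≤ 1`.
-/
theorem S_update_le {a : Fin n → ℝ} (hX : IsReference X) (ha : a ⬝ᵥ X⁻¹ *ᵥ a ≤ 1)
    (h : Inv X st) : (update a st).S ≤ st.S + (1 / 2 : ℝ) • 1 := by
  have hP := weightMatrix_posDef st.S
  have h1 : a ⬝ᵥ weightMatrix st.S *ᵥ a ≤ 4 * n := by
    calc a ⬝ᵥ weightMatrix st.S *ᵥ a = ∑ i, expWeight st.S i * a i ^ 2 := by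
          simp only [weightMatrix, dotProduct, mulVec_diagonal]
          exact Finset.sum_congr rfl fun i _ => by ring
      _ ≤ ∑ i, expWeight st.S i * 2 := by
          refine Finset.sum_le_sum fun i _ => ?_
          exact mul_le_mul_of_nonneg_left (sq_apply_le hX ha i) (Real.exp_pos _).le
      _ ≤ 4 * n := by
          rw [← Finset.sum_mul]
          linarith [h.sum_le_two_mul hX]
  have h2 : stepWeight n * (a ⬝ᵥ weightMatrix st.S *ᵥ a) ≤ (1 / 2 : ℝ) ^ 2 := by
    rw [stepWeight, one_div, inv_mul_le_iff₀ (by positivity)]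
    linarith
  have h3 := le_add_smul_inv hP (geoMean_posDef hP h.posDef_M)
    (geoMean_posDef hP (posDef_update (a := a) h)) stepWeight_pos.le (by norm_num) h2
    (by rw [geoMean_mul_mul hP (posDef_update h), geoMean_mul_mul hP h.posDef_M])
  have h4 : (weightMatrix st.S)⁻¹ ≤ 1 := by
    have e : (weightMatrix st.S)⁻¹ = diagonal fun i => (expWeight st.S i)⁻¹ := by
      apply Matrix.inv_eq_right_inv
      rw [weightMatrix, diagonal_mul_diagonal, ← diagonal_one]
      congr 1
      funext i
      exact mul_inv_cancel₀ (Real.exp_pos _).ne'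
    rw [e, Matrix.le_iff, ← diagonal_one, diagonal_sub, posSemidef_diagonal_iff]
    exact fun i => sub_nonneg.2 (inv_le_one_of_one_le₀ (h.one_le_expWeight i))
  have h5 : (1 / 2 : ℝ) • (weightMatrix st.S)⁻¹ ≤ (1 / 2 : ℝ) • 1 := by
    rw [Matrix.le_iff, ← smul_sub]
    exact (Matrix.le_iff.1 h4).smul (by norm_num : (0 : ℝ) ≤ 1 / 2)
  have h6 := h3.trans (add_le_add_right h5 _)
  have h7 := sub_le_iff_le_add'.2 h6
  exact add_le_add_right h7 _

theorem inv_update {a : Fin n → ℝ} (hX : IsReference X) (ha : a ⬝ᵥ X⁻¹ *ᵥ a ≤ 1)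
    (hc : 1 < a ⬝ᵥ st.S⁻¹ *ᵥ a) (h : Inv X st) : Inv X (update a st) := by
  have hP := weightMatrix_posDef st.S
  have hM' := posDef_update (a := a) h
  have hS := le_S_update (a := a) h
  have hS2 := S_update_le hX ha h
  set st' := update a st with hst'
  set G' := geoMean (weightMatrix st.S) st'.M with hG'
  have hG'pd : G'.PosDef := geoMean_posDef hP hM'
  have hS'eq : st'.S = st.S + (G' - st.mean) := rfl
  have hG'S : G' ≤ st'.S := by
    have := add_le_add_left h.mean_le_S (G' - st.mean)
    rw [hS'eq]
    simpa using this
  -- Passing to the new, larger weights lowers the mean but raises the fidelity; both directions are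
  -- favourable.
  have hmean : st'.mean ≤ G' := geoMean_anti hP hM' (weightMatrix_mono hS)
  have hpot : (weightMatrix st.S * G').trace ≤ st'.potential :=
    trace_mul_geoMean_mono hP hM' (weightMatrix_mono hS)
  have hw := stepWeight_pos (n := n)
  -- As `1 ≤ S`, an increase by at most `1 / 2` gives `G' ≤ S' ≤ (3 / 2) S`, so `a` is still nearly
  -- uncovered by `G'`. This drives the fidelity gain `w / 3`.
  have hcover : 2 / 3 ≤ a ⬝ᵥ G'⁻¹ *ᵥ a := by
    have hS3 : st'.S ≤ (3 / 2 : ℝ) • st.S := by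
      refine hS2.trans ?_
      rw [Matrix.le_iff]
      convert (Matrix.le_iff.1 h.one_le_S).smul (by norm_num : (0 : ℝ) ≤ 1 / 2) using 1
      module
    have h1 := inv_quadForm_anti hG'pd (hG'S.trans hS3) a
    have hinv : ((3 / 2 : ℝ) • st.S)⁻¹ = (2 / 3 : ℝ) • st.S⁻¹ := by
      apply Matrix.inv_eq_right_inv
      rw [Matrix.smul_mul, Matrix.mul_smul, smul_smul, PosDef.mul_inv_self h.posDef_S]
      norm_num
    rw [hinv, smul_mulVec, dotProduct_smul, smul_eq_mul] at h1
    linarith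
  have hinc : st.potential + stepWeight n / 3 ≤ (weightMatrix st.S * G').trace := by
    have h1 := trace_mul_geoMean_add hP h.posDef_M hM'
    have h2 : stepWeight n * (2 / 3) ≤ stepWeight n * (a ⬝ᵥ G'⁻¹ *ᵥ a) :=
      mul_le_mul_of_nonneg_left hcover hw.le
    have h3 : st.potential = (weightMatrix st.S * geoMean (weightMatrix st.S) st.M).trace := rfl
    change 2 * (weightMatrix st.S * geoMean (weightMatrix st.S) st.M).trace +
      stepWeight n * (a ⬝ᵥ G'⁻¹ *ᵥ a) ≤ 2 * (weightMatrix st.S * G').trace at h1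
    linarith
  refine ⟨hM', h.one_le_S.trans hS, hmean.trans hG'S, add_nonneg h.W_nonneg hw.le, ?_, ?_, ?_⟩
  · change ((st.M + stepWeight n • vecMulVec a a) * X⁻¹).trace ≤ n + (st.W + stepWeight n)
    rw [Matrix.add_mul, Matrix.smul_mul, trace_add, trace_smul, trace_vecMulVec_mul, smul_eq_mul]
    nlinarith [h.trace_le]
  · change st.W + stepWeight n ≤ 3 * st'.potential
    linarith [h.W_le]
  · have h1 : ∀ i, expWeight st'.S i ≤
        expWeight st.S i + (1 / 14) * (expWeight st.S i * (G' - st.mean) i i) := by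
      intro i
      have e : expWeight st'.S i = expWeight st.S i * Real.exp ((G' - st.mean) i i / 28) := by
        rw [expWeight, expWeight, ← Real.exp_add, hS'eq, Matrix.add_apply]
        congr 1
        ring
      have hd0 : 0 ≤ (G' - st.mean) i i := by
        have := diag_mono hS i
        rw [hS'eq, Matrix.add_apply] at this
        linarith
      have hd1 : (G' - st.mean) i i ≤ 1 / 2 := by
        have := diag_mono hS2 i
        rw [hS'eq, Matrix.add_apply, Matrix.add_apply, Matrix.smul_apply, one_apply_eq] at this
        simpa using this
      -- From `|exp x - 1| ≤ 2 |x|` for `|x| ≤ 1`; the rate 28 thus produces the constant 14 of the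
      -- invariant.
      have hexp : Real.exp ((G' - st.mean) i i / 28) ≤ 1 + (G' - st.mean) i i / 14 := by
        set d := (G' - st.mean) i i
        have := Real.abs_exp_sub_one_le (x := d / 28) (by rw [abs_le]; constructor <;> linarith)
        rw [abs_of_nonneg (a := d / 28) (by linarith)] at this
        linarith [le_abs_self (Real.exp (d / 28) - 1)]
      rw [e]
      have hp : 0 < expWeight st.S i := Real.exp_pos _
      nlinarith
    have h2 : ∑ i, expWeight st'.S i ≤ ∑ i, expWeight st.S i +
        (1 / 14) * ((weightMatrix st.S * G').trace - st.potential) := by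
      have h3 : (weightMatrix st.S * G').trace - st.potential =
          ∑ i, expWeight st.S i * (G' - st.mean) i i := by
        rw [potential, ← trace_sub, ← Matrix.mul_sub, trace_weightMatrix_mul]
      rw [h3, Finset.mul_sum, ← Finset.sum_add_distrib]
      exact Finset.sum_le_sum fun i _ => h1 i
    linarith [h.sum_le]

theorem inv_step {a : Fin n → ℝ} (hX : IsReference X) (ha : a ⬝ᵥ X⁻¹ *ᵥ a ≤ 1)
    (h : Inv X st) : Inv X (step a st) := by
  rw [step]
  split_ifs with hc
  · exact h
  · exact inv_update hX ha (not_le.1 hc) h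

theorem le_S_step {a : Fin n → ℝ} (h : Inv X st) : st.S ≤ (step a st).S := by
  rw [step]
  split_ifs with hc
  · exact le_rfl
  · exact le_S_update h

/-- As long as `a` is uncovered every step adds weight, so failure to cover forces the total weight
up. -/
theorem iterate_step {a : Fin n → ℝ} (hX : IsReference X) (ha : a ⬝ᵥ X⁻¹ *ᵥ a ≤ 1)
    (h : Inv X st) (k : ℕ) :
    Inv X ((step a)^[k] st) ∧ st.S ≤ ((step a)^[k] st).S ∧
      (a ⬝ᵥ ((step a)^[k] st).S⁻¹ *ᵥ a ≤ 1 ∨ k * stepWeight n ≤ ((step a)^[k] st).W) := by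
  induction k with
  | zero => exact ⟨h, le_rfl, .inr (by simpa using h.W_nonneg)⟩
  | succ k ih =>
    rw [Function.iterate_succ_apply']
    obtain ⟨h1, h2, h3⟩ := ih
    refine ⟨inv_step hX ha h1, h2.trans (le_S_step h1), ?_⟩
    rw [step]
    split_ifs with hc
    · exact .inl hc
    · refine .inr ?_
      have := h3.resolve_left hc
      change _ ≤ ((step a)^[k] st).W + stepWeight n
      push_cast
      linarith

theorem inv_absorb {a : Fin n → ℝ} (hX : IsReference X) (ha : a ⬝ᵥ X⁻¹ *ᵥ a ≤ 1)
    (h : Inv X st) : Inv X (absorb a st) := (iterate_step hX ha h _).1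

theorem le_S_absorb {a : Fin n → ℝ} (hX : IsReference X) (ha : a ⬝ᵥ X⁻¹ *ᵥ a ≤ 1)
    (h : Inv X st) : st.S ≤ (absorb a st).S := (iterate_step hX ha h _).2.1

theorem absorb_covers {a : Fin n → ℝ} (hX : IsReference X) (ha : a ⬝ᵥ X⁻¹ *ᵥ a ≤ 1)
    (h : Inv X st) : a ⬝ᵥ (absorb a st).S⁻¹ *ᵥ a ≤ 1 := by
  obtain ⟨h1, -, h3⟩ := iterate_step hX ha h (numSteps n)
  refine h3.resolve_right fun h4 => ?_
  have h5 := h1.W_le_const hX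
  have hn : (0 : ℝ) ≤ n := n.cast_nonneg
  -- Here `700 / 16 > 42`, which exceeds the bound `W ≤ 42 n`.
  have h6 : (numSteps n : ℝ) * stepWeight n = 700 / 16 * (n + 1) := by
    rw [stepWeight, numSteps]
    push_cast
    field_simp
  rw [h6] at h4
  linarith

end CoverState

end CoverState

/-! ### Factorization norms and the offline reference matrix -/

section Norms

theorem l2norm_sq {ι : Type*} [Fintype ι] (v : ι → ℝ) : l2norm v ^ 2 = v ⬝ᵥ v := by
  rw [l2norm, EuclideanSpace.norm_sq_eq]
  exact Finset.sum_congr rfl fun i _ => by rw [Real.norm_eq_abs, sq_abs, sq]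

theorem l2norm_nonneg {ι : Type*} [Fintype ι] (v : ι → ℝ) : 0 ≤ l2norm v := norm_nonneg _

theorem l2norm_le {ι : Type*} [Fintype ι] {v : ι → ℝ} {c : ℝ} (hc : 0 ≤ c)
    (h : v ⬝ᵥ v ≤ c ^ 2) : l2norm v ≤ c := by
  rw [← l2norm_sq] at h
  exact abs_le_of_sq_le_sq' h hc |>.2

theorem sq_dotProduct_le_l2norm {ι : Type*} [Fintype ι] (u v : ι → ℝ) :
    (u ⬝ᵥ v) ^ 2 ≤ l2norm u ^ 2 * l2norm v ^ 2 := by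
  rw [l2norm_sq, l2norm_sq]
  simp only [dotProduct, ← sq]
  exact Finset.sum_mul_sq_le_sq_mul_sq _ _ _

variable {m n k : ℕ}

theorem norm1to2_nonneg (R : Matrix (Fin k) (Fin n) ℝ) : 0 ≤ norm1to2 R :=
  Real.iSup_nonneg fun _ => l2norm_nonneg _

theorem norm2toInf_nonneg (L : Matrix (Fin m) (Fin k) ℝ) : 0 ≤ norm2toInf L :=
  Real.iSup_nonneg fun _ => l2norm_nonneg _

theorem l2norm_col_le (R : Matrix (Fin k) (Fin n) ℝ) (j : Fin n) :
    l2norm (fun i => R i j) ≤ norm1to2 R :=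
  le_ciSup (f := fun j => l2norm (fun i => R i j)) (Set.finite_range _).bddAbove j

theorem l2norm_row_le (L : Matrix (Fin m) (Fin k) ℝ) (i : Fin m) :
    l2norm (L i) ≤ norm2toInf L :=
  le_ciSup (f := fun i => l2norm (fun j => L i j)) (Set.finite_range _).bddAbove i

theorem norm1to2_le {R : Matrix (Fin k) (Fin n) ℝ} {c : ℝ} (hc : 0 ≤ c)
    (h : ∀ j, (Rᵀ * R) j j ≤ c ^ 2) : norm1to2 R ≤ c :=
  Real.iSup_le (fun j => l2norm_le hc (h j)) hc

theorem gamma2_nonneg (A : Matrix (Fin m) (Fin n) ℝ) : 0 ≤ gamma2 A := by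
  refine Real.sInf_nonneg ?_
  rintro x ⟨k, L, R, -, rfl⟩
  exact mul_nonneg (norm2toInf_nonneg L) (norm1to2_nonneg R)

theorem gamma2_le (L : Matrix (Fin m) (Fin k) ℝ) (R : Matrix (Fin k) (Fin n) ℝ) :
    gamma2 (L * R) ≤ norm2toInf L * norm1to2 R := by
  refine csInf_le ⟨0, ?_⟩ ⟨k, L, R, rfl, rfl⟩
  rintro x ⟨k, L, R, -, rfl⟩
  exact mul_nonneg (norm2toInf_nonneg L) (norm1to2_nonneg R)

theorem le_gamma2 {A : Matrix (Fin m) (Fin n) ℝ} {c : ℝ}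
    (h : ∀ (k : ℕ) (L : Matrix (Fin m) (Fin k) ℝ) (R : Matrix (Fin k) (Fin n) ℝ), L * R = A →
      c ≤ norm2toInf L * norm1to2 R) : c ≤ gamma2 A := by
  refine le_csInf ⟨_, n, A, 1, Matrix.mul_one A, rfl⟩ ?_
  rintro x ⟨k, L, R, hLR, rfl⟩
  exact h k L R hLR

theorem exists_factorization_lt {A : Matrix (Fin m) (Fin n) ℝ} {g : ℝ} (h : gamma2 A < g) :
    ∃ (k : ℕ) (L : Matrix (Fin m) (Fin k) ℝ) (R : Matrix (Fin k) (Fin n) ℝ), L * R = A ∧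
      norm2toInf L * norm1to2 R < g := by
  by_contra! hc
  exact h.not_ge (le_gamma2 hc)

theorem abs_apply_le_gamma2 (A : Matrix (Fin m) (Fin n) ℝ) (i : Fin m) (j : Fin n) :
    |A i j| ≤ gamma2 A := by
  refine le_gamma2 fun k L R hLR => ?_
  have h1 : A i j = L i ⬝ᵥ fun l => R l j := by rw [← hLR]; rfl
  have h2 := sq_dotProduct_le_l2norm (L i) fun l => R l j
  rw [← h1, ← mul_pow] at h2
  refine (abs_le_of_sq_le_sq h2
    (mul_nonneg (l2norm_nonneg _) (l2norm_nonneg _))).trans ?_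
  exact mul_le_mul (l2norm_row_le L i) (l2norm_col_le R j) (l2norm_nonneg _)
    (norm2toInf_nonneg L)

theorem norm_row_le_gamma2 (A : Matrix (Fin m) (Fin n) ℝ) (i : Fin m) : ‖A i‖ ≤ gamma2 A :=
  (pi_norm_le_iff_of_nonneg (gamma2_nonneg A)).2 fun j => abs_apply_le_gamma2 A i j

theorem gamma2_transpose_le (A : Matrix (Fin m) (Fin n) ℝ) : gamma2 Aᵀ ≤ gamma2 A := by
  refine le_gamma2 fun k L R hLR => ?_
  rw [← hLR, transpose_mul, mul_comm]
  exact gamma2_le Rᵀ Lᵀ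

theorem gamma2_transpose (A : Matrix (Fin m) (Fin n) ℝ) : gamma2 Aᵀ = gamma2 A :=
  (gamma2_transpose_le A).antisymm (gamma2_transpose_le Aᵀ)

theorem gamma2_firstRows_le (Q : Matrix (Fin m) (Fin n) ℝ) (t : ℕ) (ht : t ≤ m) :
    gamma2 (firstRows Q t ht) ≤ gamma2 Q := by
  refine le_gamma2 fun k L R hLR => ?_
  have h1 : firstRows Q t ht = firstRows L t ht * R := by rw [← hLR]; rfl
  rw [h1]
  refine (gamma2_le _ _).trans (mul_le_mul_of_nonneg_right ?_ (norm1to2_nonneg R))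
  exact Real.iSup_le (fun i => l2norm_row_le L (Fin.castLE ht i)) (norm2toInf_nonneg L)

/-- A factorization of value less than `g` yields a covering matrix for the scaled rows. -/
theorem exists_isReference {Q : Matrix (Fin m) (Fin n) ℝ} {g : ℝ} (h : gamma2 Q < g) :
    ∃ X : Matrix (Fin n) (Fin n) ℝ, IsReference X ∧
      ∀ i, (g⁻¹ • Q i) ⬝ᵥ X⁻¹ *ᵥ (g⁻¹ • Q i) ≤ 1 := by
  have hg : 0 < g := (gamma2_nonneg Q).trans_lt h
  obtain ⟨k, L, R, rfl, hLR⟩ := exists_factorization_lt h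
  set ν := norm1to2 R with hν
  have hν0 : 0 ≤ ν := norm1to2_nonneg R
  have hRR : (Rᵀ * R).PosSemidef := by simpa using posSemidef_conjTranspose_mul_self R
  -- The summand `1` gives invertibility and `1 ≤ X`; the normalized Gram matrix contributes at most
  -- 1 to the diagonal, also when `ν = 0`, where the inverse is `0`.
  have hX : IsReference (1 + (ν ^ 2)⁻¹ • (Rᵀ * R)) := by
    refine ⟨?_, fun j => ?_⟩
    · rw [Matrix.le_iff, add_sub_cancel_left]
      exact hRR.smul (by positivity : 0 ≤ (ν ^ 2)⁻¹)
    · rw [Matrix.add_apply, one_apply_eq, Matrix.smul_apply, smul_eq_mul]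
      have h1 : (Rᵀ * R) j j = l2norm (fun i => R i j) ^ 2 := by rw [l2norm_sq]; rfl
      have h2 : (Rᵀ * R) j j ≤ ν ^ 2 := by
        rw [h1]
        exact pow_le_pow_left₀ (l2norm_nonneg _) (l2norm_col_le R j) 2
      have h3 : (ν ^ 2)⁻¹ * (Rᵀ * R) j j ≤ 1 := inv_mul_le_one_of_le₀ h2 (by positivity)
      linarith
  refine ⟨_, hX, fun i => ?_⟩
  set X := 1 + (ν ^ 2)⁻¹ • (Rᵀ * R) with hXdef
  set q := (L * R) i with hq
  set y := X⁻¹ *ᵥ q with hy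
  have hXy : X *ᵥ y = q := by simp [y, PosDef.mul_inv_self hX.posDef]
  suffices hs : q ⬝ᵥ y ≤ g ^ 2 by
    rw [mulVec_smul, smul_dotProduct, dotProduct_smul, smul_eq_mul, smul_eq_mul, ← mul_assoc,
      ← mul_inv, ← sq]
    exact inv_mul_le_one_of_le₀ hs (by positivity)
  have h1 : q ⬝ᵥ y = L i ⬝ᵥ R *ᵥ y := (dotProduct_mulVec (L i) R y).symm
  have h2 := sq_dotProduct_le_l2norm (L i) (R *ᵥ y)
  rw [← h1, l2norm_sq (R *ᵥ y)] at h2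
  have h3 : q ⬝ᵥ y = y ⬝ᵥ y + (ν ^ 2)⁻¹ * ((R *ᵥ y) ⬝ᵥ (R *ᵥ y)) := by
    have h4 : (R *ᵥ y) ⬝ᵥ (R *ᵥ y) = y ⬝ᵥ (Rᵀ * R) *ᵥ y := by
      rw [← mulVec_mulVec, dotProduct_mulVec y, vecMul_transpose]
    rw [h4, dotProduct_comm, ← hXy, hXdef, add_mulVec, dotProduct_add, one_mulVec, smul_mulVec,
      dotProduct_smul, smul_eq_mul]
  have hyy : 0 ≤ y ⬝ᵥ y := by rw [← l2norm_sq]; positivity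
  have hRy : 0 ≤ (R *ᵥ y) ⬝ᵥ (R *ᵥ y) := by rw [← l2norm_sq]; positivity
  rcases hν0.eq_or_lt with h0 | h0
  · have hR : R = 0 := by
      ext a b
      have h5 : l2norm (fun i => R i b) ^ 2 = 0 := by
        have := l2norm_col_le R b
        rw [← hν, ← h0] at this
        rw [le_antisymm this (l2norm_nonneg _)]
        norm_num
      rw [l2norm_sq, dotProduct_self_eq_zero] at h5
      exact congrFun h5 a
    rw [h1, hR]
    simp
    positivity
  · set z := (R *ᵥ y) ⬝ᵥ (R *ᵥ y) with hz
    -- Combined with `(q·y)² ≤ ‖L i‖² z` this gives `(q·y)² ≤ g² (q·y)`, and one factor cancels.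
    have h5 : z ≤ ν ^ 2 * (q ⬝ᵥ y) := by
      rw [h3]
      have : ν ^ 2 * ((ν ^ 2)⁻¹ * z) = z := by field_simp
      nlinarith [mul_nonneg (sq_nonneg ν) hyy]
    have h6 : l2norm (L i) * ν ≤ g :=
      (mul_le_mul_of_nonneg_right (l2norm_row_le L i) hν0).trans hLR.le
    have h7 : (l2norm (L i) * ν) ^ 2 ≤ g ^ 2 :=
      pow_le_pow_left₀ (mul_nonneg (l2norm_nonneg _) hν0) h6 2
    have h8 : 0 ≤ q ⬝ᵥ y := by rw [h3]; positivity
    have h9 : (q ⬝ᵥ y) ^ 2 ≤ g ^ 2 * (q ⬝ᵥ y) := by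
      calc (q ⬝ᵥ y) ^ 2 ≤ l2norm (L i) ^ 2 * z := h2
        _ ≤ l2norm (L i) ^ 2 * (ν ^ 2 * (q ⬝ᵥ y)) := by gcongr
        _ = (l2norm (L i) * ν) ^ 2 * (q ⬝ᵥ y) := by ring
        _ ≤ _ := by gcongr
    rcases h8.eq_or_lt with h10 | h10
    · rw [← h10]; positivity
    · rw [sq] at h9
      exact le_of_mul_le_mul_right h9 h10

end Norms

/-! ### Running the procedure on a history of rows -/

section Phases

variable {n : ℕ}

open Classical in
/-- The covering procedure for the rows of a matrix, for the scale `g`.  It stops for good once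
the factorization norm of the rows reaches `g`. -/
def phase (g : ℝ) : {t : ℕ} → Matrix (Fin t) (Fin n) ℝ → CoverState n
  | 0, _ => CoverState.start n
  | t + 1, Q =>
    if gamma2 Q < g then
      CoverState.absorb (g⁻¹ • Q (Fin.last t)) (phase g (firstRows Q t t.le_succ))
    else phase g (firstRows Q t t.le_succ)

/-- The reference may change with every arrival: the procedure never uses `X`, so its whole history
can be replayed against the reference of the current matrix. -/
theorem inv_phase_of_lt {g : ℝ} {X : Matrix (Fin n) (Fin n) ℝ} (hX : IsReference X) :
    ∀ {t : ℕ} (Q : Matrix (Fin t) (Fin n) ℝ), gamma2 Q < g →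
      (∀ i, (g⁻¹ • Q i) ⬝ᵥ X⁻¹ *ᵥ (g⁻¹ • Q i) ≤ 1) → CoverState.Inv X (phase g Q)
  | 0, _, _, _ => CoverState.inv_start hX
  | t + 1, Q, hQ, hc => by
    rw [phase, if_pos hQ]
    exact CoverState.inv_absorb hX (hc _)
      (inv_phase_of_lt hX _ ((gamma2_firstRows_le Q t t.le_succ).trans_lt hQ) fun i => hc _)

/-- A stopped procedure keeps the reference of its last active prefix, so the diagonal bound holds
at every scale, including those that are too small. -/
theorem exists_inv_phase (g : ℝ) : ∀ {t : ℕ} (Q : Matrix (Fin t) (Fin n) ℝ),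
    ∃ X, IsReference X ∧ CoverState.Inv X (phase g Q)
  | 0, _ => by
    have : IsReference (1 : Matrix (Fin n) (Fin n) ℝ) := ⟨le_rfl, fun i => by simp⟩
    exact ⟨1, this, CoverState.inv_start this⟩
  | t + 1, Q => by
    by_cases hQ : gamma2 Q < g
    · obtain ⟨X, hX, hc⟩ := exists_isReference hQ
      exact ⟨X, hX, inv_phase_of_lt hX Q hQ hc⟩
    · rw [phase, if_neg hQ]
      exact exists_inv_phase g _

theorem one_le_phase (g : ℝ) {t : ℕ} (Q : Matrix (Fin t) (Fin n) ℝ) : 1 ≤ (phase g Q).S :=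
  let ⟨_, _, h⟩ := exists_inv_phase g Q
  h.one_le_S

theorem diag_phase_le (g : ℝ) {t : ℕ} (Q : Matrix (Fin t) (Fin n) ℝ) (i : Fin n) :
    (phase g Q).S i i ≤ 29 * (1 + Real.log n) :=
  let ⟨_, hX, h⟩ := exists_inv_phase g Q
  h.diag_S_le hX i

theorem phase_firstRows_le (g : ℝ) {t : ℕ} (Q : Matrix (Fin (t + 1)) (Fin n) ℝ) :
    (phase g (firstRows Q t t.le_succ)).S ≤ (phase g Q).S := by
  by_cases hQ : gamma2 Q < g
  · obtain ⟨X, hX, hc⟩ := exists_isReference hQ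
    conv_rhs => rw [phase, if_pos hQ]
    exact CoverState.le_S_absorb hX (hc _)
      (inv_phase_of_lt hX _ ((gamma2_firstRows_le Q t t.le_succ).trans_lt hQ) fun i => hc _)
  · conv_rhs => rw [phase, if_neg hQ]

theorem phase_covers {g : ℝ} {t : ℕ} {Q : Matrix (Fin (t + 1)) (Fin n) ℝ} (hQ : gamma2 Q < g) :
    Q (Fin.last t) ⬝ᵥ (phase g Q).S⁻¹ *ᵥ Q (Fin.last t) ≤ g ^ 2 := by
  have hg : 0 < g := (gamma2_nonneg Q).trans_lt hQ
  obtain ⟨X, hX, hc⟩ := exists_isReference hQ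
  have h1 := CoverState.absorb_covers hX (hc (Fin.last t))
    (inv_phase_of_lt hX _ ((gamma2_firstRows_le Q t t.le_succ).trans_lt hQ) fun i => hc _)
  rw [phase, if_pos hQ]
  rw [mulVec_smul, smul_dotProduct, dotProduct_smul, smul_eq_mul, smul_eq_mul, ← mul_assoc,
    ← mul_inv, ← sq, inv_mul_le_iff₀ (by positivity), mul_one] at h1
  exact h1

/-- The sup norm of the first nonzero row, or `0` if all rows vanish. -/
def firstNorm : {t : ℕ} → Matrix (Fin t) (Fin n) ℝ → ℝ
  | 0, _ => 0
  | t + 1, Q =>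
    if firstNorm (firstRows Q t t.le_succ) = 0 then ‖Q (Fin.last t)‖
    else firstNorm (firstRows Q t t.le_succ)

theorem firstNorm_nonneg : ∀ {t : ℕ} (Q : Matrix (Fin t) (Fin n) ℝ), 0 ≤ firstNorm Q
  | 0, _ => le_rfl
  | t + 1, Q => by
    rw [firstNorm]
    split_ifs
    · exact norm_nonneg _
    · exact firstNorm_nonneg _

theorem firstNorm_le_gamma2 : ∀ {t : ℕ} (Q : Matrix (Fin t) (Fin n) ℝ), firstNorm Q ≤ gamma2 Q
  | 0, Q => gamma2_nonneg Q
  | t + 1, Q => by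
    rw [firstNorm]
    split_ifs
    · exact norm_row_le_gamma2 _ _
    · exact (firstNorm_le_gamma2 _).trans (gamma2_firstRows_le _ _ _)

theorem firstNorm_succ_of_ne {t : ℕ} {Q : Matrix (Fin (t + 1)) (Fin n) ℝ}
    (h : firstNorm (firstRows Q t t.le_succ) ≠ 0) :
    firstNorm Q = firstNorm (firstRows Q t t.le_succ) := by
  rw [firstNorm, if_neg h]

theorem last_eq_zero_of_firstNorm {t : ℕ} {Q : Matrix (Fin (t + 1)) (Fin n) ℝ}
    (h : firstNorm Q = 0) : Q (Fin.last t) = 0 := by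
  rw [firstNorm] at h
  split_ifs at h with h0
  · exact norm_eq_zero.1 h
  · exact absurd h h0

theorem firstNorm_eq_zero : ∀ {t : ℕ} {Q : Matrix (Fin t) (Fin n) ℝ}, (∀ i, Q i = 0) →
    firstNorm Q = 0
  | 0, _, _ => rfl
  | t + 1, Q, h => by
    have h1 : firstNorm (firstRows Q t t.le_succ) = 0 := firstNorm_eq_zero fun i => h _
    rw [firstNorm, if_pos h1]
    exact norm_eq_zero.2 (h _)

theorem firstNorm_firstRows {m : ℕ} (Q : Matrix (Fin m) (Fin n) ℝ) (s : Fin m)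
    (h0 : ∀ i, i < s → Q i = 0) (hs : Q s ≠ 0) (t : ℕ) (hst : s < t) (ht : t ≤ m) :
    firstNorm (firstRows Q t ht) = ‖Q s‖ := by
  induction t with
  | zero => omega
  | succ t ih =>
    rcases (Nat.lt_succ_iff.1 hst).eq_or_lt with h | h
    · have h1 : firstNorm (firstRows (firstRows Q (t + 1) ht) t t.le_succ) = 0 :=
        firstNorm_eq_zero fun i => h0 _ (by simp [Fin.lt_def, h])
      rw [firstNorm, if_pos h1]
      exact congrArg (fun i => ‖Q i‖) (Fin.ext h.symm)
    · have h1 : firstNorm (firstRows (firstRows Q (t + 1) ht) t t.le_succ) = ‖Q s‖ :=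
        ih h (by omega)
      rw [firstNorm_succ_of_ne (by rw [h1]; exact norm_ne_zero_iff.2 hs), h1]

end Phases

/-! ### Combining the scales -/

section TotalCover

variable {n : ℕ}

theorem smul_le_smul_of_loewner {A B : Matrix (Fin n) (Fin n) ℝ} (h : A ≤ B) {c : ℝ}
    (hc : 0 ≤ c) : c • A ≤ c • B := by
  rw [Matrix.le_iff, ← smul_sub]
  exact (Matrix.le_iff.1 h).smul hc

/-- The index of the scale `2 ^ j * firstNorm Q` in use for `Q`. -/
def level {t : ℕ} (Q : Matrix (Fin t) (Fin n) ℝ) : ℕ :=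
  -- The `+ 1` makes `γ₂ < 2 ^ level * firstNorm` strict, as the procedure requires, while the scale
  -- stays at most `4 γ₂`.
  ⌈Real.logb 2 (gamma2 Q / firstNorm Q)⌉₊ + 1

section

variable {t : ℕ} {Q : Matrix (Fin t) (Fin n) ℝ}

theorem firstNorm_pos (h : firstNorm Q ≠ 0) : 0 < firstNorm Q :=
  (firstNorm_nonneg Q).lt_of_ne' h

theorem one_le_ratio (h : firstNorm Q ≠ 0) : 1 ≤ gamma2 Q / firstNorm Q :=
  (one_le_div (firstNorm_pos h)).2 (firstNorm_le_gamma2 Q)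

theorem gamma2_lt_scale (h : firstNorm Q ≠ 0) : gamma2 Q < 2 ^ level Q * firstNorm Q := by
  have h0 := firstNorm_pos h
  have h1 := one_le_ratio h
  rw [← div_lt_iff₀ h0, ← Real.rpow_natCast, ← Real.logb_lt_iff_lt_rpow one_lt_two (by linarith),
    level]
  push_cast
  linarith [Nat.le_ceil (Real.logb 2 (gamma2 Q / firstNorm Q))]

theorem level_lt (h : firstNorm Q ≠ 0) :
    (level Q : ℝ) < Real.logb 2 (gamma2 Q / firstNorm Q) + 2 := by
  have h1 := Nat.ceil_lt_add_one (Real.logb_nonneg one_lt_two (one_le_ratio h))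
  rw [level]
  push_cast
  linarith

theorem scale_le (h : firstNorm Q ≠ 0) : 2 ^ level Q * firstNorm Q ≤ 4 * gamma2 Q := by
  have h0 := firstNorm_pos h
  have h1 := one_le_ratio h
  rw [← le_div_iff₀ h0, mul_div_assoc, ← Real.rpow_natCast]
  calc (2 : ℝ) ^ (level Q : ℝ)
      ≤ 2 ^ (Real.logb 2 (gamma2 Q / firstNorm Q) + 2) :=
        Real.rpow_le_rpow_of_exponent_le one_le_two (level_lt h).le
    _ = 4 * (gamma2 Q / firstNorm Q) := by
        rw [Real.rpow_add two_pos, Real.rpow_logb two_pos (by norm_num) (by linarith), mul_comm]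
        norm_num

theorem level_add_one_le (h : firstNorm Q ≠ 0) :
    (level Q : ℝ) + 1 ≤ 3 * (1 + Real.log (gamma2 Q / firstNorm Q)) := by
  have h1 := level_lt h
  have h2 := Real.log_nonneg (one_le_ratio h)
  have h3 : Real.logb 2 (gamma2 Q / firstNorm Q) ≤ 3 * Real.log (gamma2 Q / firstNorm Q) := by
    rw [Real.logb, div_le_iff₀ (Real.log_pos one_lt_two)]
    nlinarith [Real.log_two_gt_d9]
  linarith

end

theorem level_firstRows_le {t : ℕ} {Q : Matrix (Fin (t + 1)) (Fin n) ℝ}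
    (h : firstNorm (firstRows Q t t.le_succ) ≠ 0) :
    level (firstRows Q t t.le_succ) ≤ level Q := by
  have h0 := firstNorm_pos h
  have h1 := one_le_ratio h
  rw [level, level, firstNorm_succ_of_ne h]
  refine Nat.add_le_add_right (Nat.ceil_mono ?_) 1
  refine Real.logb_le_logb_of_le one_lt_two (by linarith) ?_
  exact div_le_div_of_nonneg_right (gamma2_firstRows_le Q t t.le_succ) h0.le

open Classical in
/-- The weighted sum of the covering matrices of all scales used so far. -/
def totalCover (ω : ℝ → ℕ → ℝ) {t : ℕ} (Q : Matrix (Fin t) (Fin n) ℝ) :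
    Matrix (Fin n) (Fin n) ℝ :=
  if firstNorm Q = 0 then 0
  else ∑ j ∈ Finset.range (level Q + 1),
    ω (firstNorm Q) j • (phase (2 ^ j * firstNorm Q) Q).S

variable {ω : ℝ → ℕ → ℝ}

theorem phase_nonneg (g : ℝ) {t : ℕ} (Q : Matrix (Fin t) (Fin n) ℝ) : 0 ≤ (phase g Q).S :=
  (posDef_of_le .one (one_le_phase g Q)).posSemidef.nonneg

theorem smul_phase_nonneg (hω : ∀ β j, 0 < β → 0 < ω β j)
    {β : ℝ} (hβ : 0 < β) (j : ℕ) {t : ℕ} (Q : Matrix (Fin t) (Fin n) ℝ) :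
    0 ≤ ω β j • (phase (2 ^ j * β) Q).S :=
  ((phase_nonneg _ Q).posSemidef.smul (hω β j hβ).le).nonneg

theorem smul_phase_le_totalCover (hω : ∀ β j, 0 < β → 0 < ω β j)
    {t : ℕ} {Q : Matrix (Fin t) (Fin n) ℝ} (h : firstNorm Q ≠ 0) :
    ω (firstNorm Q) (level Q) • (phase (2 ^ level Q * firstNorm Q) Q).S ≤ totalCover ω Q := by
  rw [totalCover, if_neg h]
  exact Finset.single_le_sum
    (f := fun j => ω (firstNorm Q) j • (phase (2 ^ j * firstNorm Q) Q).S)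
    (fun j _ => smul_phase_nonneg hω (firstNorm_pos h) j Q) (Finset.self_mem_range_succ _)

theorem totalCover_nonneg (hω : ∀ β j, 0 < β → 0 < ω β j)
    {t : ℕ} (Q : Matrix (Fin t) (Fin n) ℝ) : 0 ≤ totalCover ω Q := by
  rw [totalCover]
  split_ifs with h
  · exact le_rfl
  · exact Finset.sum_nonneg fun j _ => smul_phase_nonneg hω (firstNorm_pos h) j Q

theorem posDef_smul_phase (hω : ∀ β j, 0 < β → 0 < ω β j)
    {t : ℕ} {Q : Matrix (Fin t) (Fin n) ℝ} (h : firstNorm Q ≠ 0) :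
    (ω (firstNorm Q) (level Q) • (phase (2 ^ level Q * firstNorm Q) Q).S).PosDef :=
  (posDef_of_le .one (one_le_phase _ Q)).smul (hω _ _ (firstNorm_pos h))

theorem totalCover_posDef (hω : ∀ β j, 0 < β → 0 < ω β j)
    {t : ℕ} {Q : Matrix (Fin t) (Fin n) ℝ} (h : firstNorm Q ≠ 0) :
    (totalCover ω Q).PosDef :=
  posDef_of_le (posDef_smul_phase hω h) (smul_phase_le_totalCover hω h)

/-- Once the first nonzero row fixes the scales, each phase is monotone, and a scale that newly
joins the sum contributes a positive semidefinite term. -/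
theorem totalCover_firstRows_le (hω : ∀ β j, 0 < β → 0 < ω β j)
    {t : ℕ} (Q : Matrix (Fin (t + 1)) (Fin n) ℝ) :
    totalCover ω (firstRows Q t t.le_succ) ≤ totalCover ω Q := by
  by_cases h : firstNorm (firstRows Q t t.le_succ) = 0
  · rw [totalCover, if_pos h]
    exact totalCover_nonneg hω Q
  · have h1 := firstNorm_succ_of_ne h
    have h0 := firstNorm_pos h
    rw [totalCover, if_neg h, totalCover, if_neg (by rwa [h1]), h1]
    refine (Finset.sum_le_sum fun j _ =>
      smul_le_smul_of_loewner (phase_firstRows_le _ Q) (hω _ j h0).le).trans ?_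
    refine Finset.sum_le_sum_of_subset_of_nonneg ?_ fun j _ _ => smul_phase_nonneg hω h0 j Q
    exact Finset.range_mono (Nat.add_le_add_right (level_firstRows_le h) 1)

theorem diag_totalCover_le (hω : ∀ β j, 0 < β → 0 < ω β j)
    {t : ℕ} {Q : Matrix (Fin t) (Fin n) ℝ} (h : firstNorm Q ≠ 0)
    (i : Fin n) : totalCover ω Q i i ≤
      (∑ j ∈ Finset.range (level Q + 1), ω (firstNorm Q) j) * (29 * (1 + Real.log n)) := by
  rw [totalCover, if_neg h, Matrix.sum_apply, Finset.sum_mul]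
  refine Finset.sum_le_sum fun j _ => ?_
  rw [Matrix.smul_apply, smul_eq_mul]
  exact mul_le_mul_of_nonneg_left (diag_phase_le _ Q i) (hω _ j (firstNorm_pos h)).le

/-- The top scale alone exceeds `γ₂`, has processed the whole history and covers the row; the other
summands only enlarge the matrix. -/
theorem totalCover_covers (hω : ∀ β j, 0 < β → 0 < ω β j)
    {t : ℕ} {Q : Matrix (Fin (t + 1)) (Fin n) ℝ} (h : firstNorm Q ≠ 0) :
    Q (Fin.last t) ⬝ᵥ (totalCover ω Q)⁻¹ *ᵥ Q (Fin.last t) ≤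
      (2 ^ level Q * firstNorm Q) ^ 2 / ω (firstNorm Q) (level Q) := by
  have hpos := hω _ (level Q) (firstNorm_pos h)
  have h1 := inv_quadForm_anti (posDef_smul_phase hω h) (smul_phase_le_totalCover hω h)
    (Q (Fin.last t))
  refine h1.trans ?_
  have hinv : (ω (firstNorm Q) (level Q) • (phase (2 ^ level Q * firstNorm Q) Q).S)⁻¹ =
      (ω (firstNorm Q) (level Q))⁻¹ • (phase (2 ^ level Q * firstNorm Q) Q).S⁻¹ := by
    apply Matrix.inv_eq_right_inv
    rw [Matrix.smul_mul, Matrix.mul_smul, smul_smul, mul_inv_cancel₀ hpos.ne', one_smul,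
      PosDef.mul_inv_self (posDef_of_le .one (one_le_phase _ Q))]
  rw [hinv, smul_mulVec, dotProduct_smul, smul_eq_mul, div_eq_inv_mul]
  exact mul_le_mul_of_nonneg_left (phase_covers (gamma2_lt_scale h)) (inv_pos.2 hpos).le

end TotalCover

/-! ### From covering matrices to online algorithms -/

section Algorithms

/-- A monotone family of positive semidefinite matrices, indexed by the histories of arrivals,
that covers every arrival. -/
structure OnlineCover (n : ℕ) where
  S : {t : ℕ} → Matrix (Fin t) (Fin n) ℝ → Matrix (Fin n) (Fin n) ℝ
  S_zero : ∀ Q : Matrix (Fin 0) (Fin n) ℝ, S Q = 0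
  mono : ∀ {t : ℕ} (Q : Matrix (Fin (t + 1)) (Fin n) ℝ), S (firstRows Q t t.le_succ) ≤ S Q
  posDef_or : ∀ {t : ℕ} (Q : Matrix (Fin (t + 1)) (Fin n) ℝ),
    -- Before the first nonzero arrival the cover may vanish; the coefficients are then zero.
    (S Q).PosDef ∨ Q (Fin.last t) = 0

namespace OnlineCover

variable {n : ℕ} (C : OnlineCover n)

/-- The factor of the covering matrix, which grows with the history. -/
def factor : {t : ℕ} → Matrix (Fin t) (Fin n) ℝ → Matrix (Fin (n * t)) (Fin n) ℝ
  | 0, _ => 0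
  | t + 1, Q => Fin.append (α := Fin n → ℝ) (factor (firstRows Q t t.le_succ))
      (CFC.sqrt (C.S Q - C.S (firstRows Q t t.le_succ)) : Matrix (Fin n) (Fin n) ℝ)

theorem factor_castAdd {t : ℕ} (Q : Matrix (Fin (t + 1)) (Fin n) ℝ) (i : Fin (n * t)) :
    C.factor Q (Fin.castAdd n i) = C.factor (firstRows Q t t.le_succ) i :=
  Fin.append_left (α := Fin n → ℝ) _ _ i

theorem factor_natAdd {t : ℕ} (Q : Matrix (Fin (t + 1)) (Fin n) ℝ) (i : Fin n) :
    C.factor Q (Fin.natAdd (n * t) i) =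
      CFC.sqrt (C.S Q - C.S (firstRows Q t t.le_succ)) i :=
  Fin.append_right (α := Fin n → ℝ) _ _ i

theorem factor_transpose_mul : ∀ {t : ℕ} (Q : Matrix (Fin t) (Fin n) ℝ),
    (C.factor Q)ᵀ * C.factor Q = C.S Q
  | 0, Q => by rw [C.S_zero]; simp [factor]
  | t + 1, Q => by
    have hnn : 0 ≤ C.S Q - C.S (firstRows Q t t.le_succ) := sub_nonneg.2 (C.mono Q)
    have h1 := CFC.sqrt_mul_sqrt_self _ hnn
    have h2 := (CFC.sqrt_nonneg (C.S Q - C.S (firstRows Q t t.le_succ))).posSemidef.isHermitian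
    set B := CFC.sqrt (C.S Q - C.S (firstRows Q t t.le_succ)) with hB
    have ih := factor_transpose_mul (firstRows Q t t.le_succ)
    ext a b
    have h3 : ((C.factor Q)ᵀ * C.factor Q) a b =
        ((C.factor (firstRows Q t t.le_succ))ᵀ * C.factor (firstRows Q t t.le_succ)) a b +
          (Bᵀ * B) a b := by
      simp only [mul_apply, transpose_apply]
      refine (Fin.sum_univ_add (a := n * t) (b := n)
        (fun i => C.factor Q i a * C.factor Q i b)).trans ?_
      simp only [factor_castAdd, factor_natAdd, ← hB]
    rw [h3, ih, ← conjTranspose_eq_transpose_of_trivial, h2.eq, h1]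
    simp

/-- The coefficients of the last arrival. -/
def coeff {t : ℕ} (Q : Matrix (Fin (t + 1)) (Fin n) ℝ) : Fin (n * (t + 1)) → ℝ :=
  C.factor Q *ᵥ ((C.S Q)⁻¹ *ᵥ Q (Fin.last t))

theorem S_mulVec_inv {t : ℕ} (Q : Matrix (Fin (t + 1)) (Fin n) ℝ) :
    C.S Q *ᵥ ((C.S Q)⁻¹ *ᵥ Q (Fin.last t)) = Q (Fin.last t) := by
  rcases C.posDef_or Q with h | h
  · rw [mulVec_mulVec, PosDef.mul_inv_self h, one_mulVec]
  · simp [h]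

theorem transpose_mulVec_coeff {t : ℕ} (Q : Matrix (Fin (t + 1)) (Fin n) ℝ) :
    (C.factor Q)ᵀ *ᵥ C.coeff Q = Q (Fin.last t) := by
  rw [coeff, mulVec_mulVec, factor_transpose_mul, S_mulVec_inv]

/-- Moving the factor across the inner product leaves `Fᵀ F S⁻¹ q = q` against `S⁻¹ q`. -/
theorem coeff_dotProduct_self {t : ℕ} (Q : Matrix (Fin (t + 1)) (Fin n) ℝ) :
    C.coeff Q ⬝ᵥ C.coeff Q = Q (Fin.last t) ⬝ᵥ (C.S Q)⁻¹ *ᵥ Q (Fin.last t) := by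
  conv_lhs => rw [coeff.eq_1]
  rw [dotProduct_mulVec, ← mulVec_transpose, ← coeff, transpose_mulVec_coeff]

/-- The row arrival algorithm of a cover. -/
def rowAlgorithm (hC : ∀ {t : ℕ} (Q : Matrix (Fin t) (Fin n) ℝ) (i : Fin n), C.S Q i i ≤ 1) :
    RowArrivalAlgorithm n where
  k {t} _ := n * t
  R Q := C.factor Q
  ell Q := C.coeff Q
  k_mono {t} _ := Nat.mul_le_mul_left n t.le_succ
  R_extends Q i := C.factor_castAdd Q i
  ell_mul_R Q := by rw [← mulVec_transpose, transpose_mulVec_coeff]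
  norm_R_le Q := norm1to2_le zero_le_one fun j => by
    rw [factor_transpose_mul, one_pow]
    exact hC Q j

/-- The column arrival algorithm of a cover. -/
def columnAlgorithm (hC : ∀ {t : ℕ} (Q : Matrix (Fin (t + 1)) (Fin n) ℝ),
    Q (Fin.last t) ⬝ᵥ (C.S Q)⁻¹ *ᵥ Q (Fin.last t) ≤ 1) : ColumnArrivalAlgorithm n where
  k {t} _ := n * t
  L A := (C.factor Aᵀ)ᵀ
  r A := C.coeff Aᵀ
  k_mono {t} _ := Nat.mul_le_mul_left n t.le_succ
  L_extends A i j := congrFun (C.factor_castAdd Aᵀ j) i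
  L_mul_r A := C.transpose_mulVec_coeff Aᵀ
  norm_r_le A := l2norm_le zero_le_one <| by
    rw [coeff_dotProduct_self, one_pow]
    exact hC Aᵀ

end OnlineCover

/-- The cover of all scales with weights `ω`. -/
def scaleCover (n : ℕ) (ω : ℝ → ℕ → ℝ) (hω : ∀ β j, 0 < β → 0 < ω β j) : OnlineCover n where
  S Q := totalCover ω Q
  S_zero Q := by rw [totalCover, if_pos]; rfl
  mono Q := totalCover_firstRows_le hω Q
  posDef_or Q := by
    by_cases h : firstNorm Q = 0
    · exact .inr (last_eq_zero_of_firstNorm h)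
    · exact .inl (totalCover_posDef hω h)

/-- The weights of the column arrival algorithm. -/
def columnWeight (β : ℝ) (j : ℕ) : ℝ := (2 ^ j * β) ^ 2

theorem columnWeight_pos (β : ℝ) (j : ℕ) (hβ : 0 < β) : 0 < columnWeight β j := by
  rw [columnWeight]; positivity

theorem sum_columnWeight_le (β : ℝ) (J : ℕ) :
    ∑ j ∈ Finset.range (J + 1), columnWeight β j ≤ 4 / 3 * (2 ^ J * β) ^ 2 := by
  induction J with
  | zero => simp [columnWeight]; nlinarith [sq_nonneg β]
  | succ J ih =>
    rw [Finset.sum_range_succ]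
    have : (2 ^ (J + 1) * β) ^ 2 = 4 * (2 ^ J * β) ^ 2 := by ring
    rw [columnWeight, this]
    linarith

theorem exists_columnArrivalAlgorithm (m : ℕ) : ∃ alg : ColumnArrivalAlgorithm m,
    ∀ (N : ℕ) (A : Matrix (Fin m) (Fin N) ℝ),
      alg.AchievesValue A (25 * (gamma2 A * (1 + Real.log m) ^ 3)) := by
  have hc : ∀ {t : ℕ} (Q : Matrix (Fin (t + 1)) (Fin m) ℝ), Q (Fin.last t) ⬝ᵥ
      ((scaleCover m columnWeight columnWeight_pos).S Q)⁻¹ *ᵥ Q (Fin.last t) ≤ 1 := by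
    intro t Q
    by_cases h : firstNorm Q = 0
    · rw [last_eq_zero_of_firstNorm h]; simp
    -- The weight of the top scale is exactly its square, so the coverage bound becomes 1.
    · exact (totalCover_covers columnWeight_pos h).trans (div_self_le_one _)
  refine ⟨(scaleCover m columnWeight columnWeight_pos).columnAlgorithm hc, fun N A => ?_⟩
  have hlog : 0 ≤ Real.log m := Real.log_natCast_nonneg m
  have hγ := gamma2_nonneg A
  refine norm1to2_le (R := (scaleCover m columnWeight columnWeight_pos).factor Aᵀ)
    (by positivity) fun i => ?_
  rw [OnlineCover.factor_transpose_mul]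
  change totalCover columnWeight Aᵀ i i ≤ _
  by_cases h : firstNorm Aᵀ = 0
  · rw [totalCover, if_pos h]
    simp only [Matrix.zero_apply]
    positivity
  · have h1 := diag_totalCover_le columnWeight_pos h i
    have h2 := sum_columnWeight_le (firstNorm Aᵀ) (level Aᵀ)
    have h3 := scale_le h
    rw [gamma2_transpose] at h3
    have h0 := firstNorm_pos h
    have h4 : (2 ^ level Aᵀ * firstNorm Aᵀ) ^ 2 ≤ (4 * gamma2 A) ^ 2 :=
      pow_le_pow_left₀ (by positivity) h3 2
    have hl : 1 ≤ 1 + Real.log m := by linarith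
    have h5 : (1 + Real.log m) ≤ ((1 + Real.log m) ^ 3) ^ 2 := by
      rw [← pow_mul]
      exact le_self_pow₀ hl (by norm_num)
    calc totalCover columnWeight Aᵀ i i
        ≤ (4 / 3 * (4 * gamma2 A) ^ 2) * (29 * (1 + Real.log m)) := by
          refine h1.trans (mul_le_mul_of_nonneg_right ?_ (by positivity))
          linarith
      -- The constant is `(4 / 3) * 16 * 29 < 625 = 25²`. Only `(1 + log m) ^ (1 / 2)` is needed in
      -- the value; the exponent 3 is slack, here and for rows.
      _ ≤ 625 * gamma2 A ^ 2 * (1 + Real.log m) := by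
          have : 0 ≤ gamma2 A ^ 2 * (1 + Real.log m) := by positivity
          nlinarith
      _ ≤ 625 * gamma2 A ^ 2 * ((1 + Real.log m) ^ 3) ^ 2 := by gcongr
      _ = _ := by ring

/-- The normalization of the weights of the row arrival algorithm. -/
def rowWeightSum (c : ℝ) : ℝ := ∑' j : ℕ, 1 / ((j : ℝ) + 1) ^ (1 + 2 * c)

theorem summable_rowWeight {c : ℝ} (hc : 0 < c) :
    Summable fun j : ℕ => 1 / ((j : ℝ) + 1) ^ (1 + 2 * c) := by
  have h := (summable_nat_add_iff 1).2
    (Real.summable_one_div_nat_rpow.2 (by linarith : 1 < 1 + 2 * c))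
  simpa using h

theorem rowWeightSum_pos {c : ℝ} (hc : 0 < c) : 0 < rowWeightSum c :=
  (summable_rowWeight hc).tsum_pos (fun j => by positivity) 0 (by simp)

/-- The weights of the row arrival algorithm. -/
def rowWeight (c : ℝ) (N : ℕ) (_ : ℝ) (j : ℕ) : ℝ :=
  1 / ((j : ℝ) + 1) ^ (1 + 2 * c) / (rowWeightSum c * (29 * (1 + Real.log N)))

theorem rowWeight_pos {c : ℝ} (hc : 0 < c) (N : ℕ) (β : ℝ) (j : ℕ) (_ : 0 < β) :
    0 < rowWeight c N β j := by
  have h1 := rowWeightSum_pos hc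
  have h2 : 0 ≤ Real.log N := Real.log_natCast_nonneg N
  rw [rowWeight]
  positivity

/-- Uniformity in `J` keeps the diagonal of the cover at most 1 however many scales are opened. -/
theorem sum_rowWeight_mul_le {c : ℝ} (hc : 0 < c) (N : ℕ) (β : ℝ) (J : ℕ) :
    (∑ j ∈ Finset.range J, rowWeight c N β j) * (29 * (1 + Real.log N)) ≤ 1 := by
  have h1 := rowWeightSum_pos hc
  have h2 : 0 ≤ Real.log N := Real.log_natCast_nonneg N
  have h3 : ∑ j ∈ Finset.range J, 1 / ((j : ℝ) + 1) ^ (1 + 2 * c) ≤ rowWeightSum c :=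
    (summable_rowWeight hc).sum_le_tsum _ fun j _ => by positivity
  simp only [rowWeight]
  rw [← Finset.sum_div, div_mul_eq_mul_div, div_le_one (by positivity)]
  gcongr

theorem exists_rowArrivalAlgorithm {c : ℝ} (hc : 0 < c) (N : ℕ) :
    ∃ alg : RowArrivalAlgorithm N, ∀ (m : ℕ) (Q : Matrix (Fin m) (Fin N) ℝ),
      (Q = 0 → alg.AchievesValue Q 0) ∧
      ∀ s : Fin m, (∀ i : Fin m, i < s → Q i = 0) → Q s ≠ 0 →
        alg.AchievesValue Q
          (4 * √(29 * rowWeightSum c) * 3 ^ (1 / 2 + c) * (gamma2 Q *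
            (1 + Real.log (gamma2 Q / ‖Q s‖)) ^ (1 / 2 + c) * (1 + Real.log N) ^ 3)) := by
  have hω := rowWeight_pos hc N
  have hZ := rowWeightSum_pos hc
  have hlog : 0 ≤ Real.log N := Real.log_natCast_nonneg N
  have hd : ∀ {t : ℕ} (Q : Matrix (Fin t) (Fin N) ℝ) (i : Fin N),
      (scaleCover N (rowWeight c N) hω).S Q i i ≤ 1 := by
    intro t Q i
    change totalCover (rowWeight c N) Q i i ≤ 1
    by_cases h : firstNorm Q = 0
    · rw [totalCover, if_pos h]; simp
    · exact (diag_totalCover_le hω h i).trans (sum_rowWeight_mul_le hc N _ _)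
  have hzero : ∀ {t : ℕ} (Q : Matrix (Fin (t + 1)) (Fin N) ℝ), Q (Fin.last t) = 0 →
      ∀ γ, 0 ≤ γ → l2norm ((scaleCover N (rowWeight c N) hω).coeff Q) ≤ γ := by
    intro t Q h γ hγ
    refine l2norm_le hγ ?_
    rw [OnlineCover.coeff_dotProduct_self, h, zero_dotProduct]
    positivity
  refine ⟨(scaleCover N (rowWeight c N) hω).rowAlgorithm hd, fun m Q => ⟨?_, ?_⟩⟩
  · rintro rfl t ht
    exact hzero _ rfl 0 le_rfl
  · intro s h0 hs t ht
    have hs' : 0 < ‖Q s‖ := norm_pos_iff.2 hs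
    have hratio : 1 ≤ gamma2 Q / ‖Q s‖ := (one_le_div hs').2 (norm_row_le_gamma2 Q s)
    have hlr := Real.log_nonneg hratio
    have hγ := gamma2_nonneg Q
    set x := 1 + Real.log (gamma2 Q / ‖Q s‖) with hx
    set Qt := firstRows Q (t + 1) ht with hQt
    change l2norm ((scaleCover N (rowWeight c N) hω).coeff Qt) ≤ _
    by_cases hts : t < s
    -- Rows before the first nonzero one cost nothing.
    · exact hzero Qt (h0 _ (Fin.lt_def.2 hts)) _ (by positivity)
    have hfn : firstNorm Qt = ‖Q s‖ := firstNorm_firstRows Q s h0 hs (t + 1) (by omega) ht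
    have hne : firstNorm Qt ≠ 0 := by rw [hfn]; exact hs'.ne'
    have hγt : gamma2 Qt ≤ gamma2 Q := gamma2_firstRows_le Q _ ht
    refine l2norm_le (by positivity) ?_
    rw [OnlineCover.coeff_dotProduct_self]
    refine (totalCover_covers hω hne).trans ?_
    have h1 : (2 ^ level Qt * firstNorm Qt) ^ 2 ≤ (4 * gamma2 Q) ^ 2 := by
      have := firstNorm_pos hne
      refine pow_le_pow_left₀ (by positivity) ((scale_le hne).trans ?_) 2
      linarith
    have h2 : (level Qt : ℝ) + 1 ≤ 3 * x := by
      refine (level_add_one_le hne).trans ?_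
      rw [hfn, hx]
      have hpos : 0 < gamma2 Qt / ‖Q s‖ := by
        have := one_le_ratio hne
        rw [hfn] at this
        linarith
      gcongr
    have h3 : ((level Qt : ℝ) + 1) ^ (1 + 2 * c) ≤ (3 ^ (1 / 2 + c) * x ^ (1 / 2 + c)) ^ 2 := by
      rw [← Real.mul_rpow (by norm_num) (by linarith), ← Real.rpow_natCast,
        ← Real.rpow_mul (by positivity)]
      calc ((level Qt : ℝ) + 1) ^ (1 + 2 * c) ≤ (3 * x) ^ (1 + 2 * c) := by gcongr
        _ = _ := by congr 1; push_cast; ring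
    have hl : 1 ≤ 1 + Real.log N := by linarith
    have h5 : (1 + Real.log N) ≤ ((1 + Real.log N) ^ 3) ^ 2 := by
      rw [← pow_mul]
      exact le_self_pow₀ hl (by norm_num)
    have h6 : √(29 * rowWeightSum c) ^ 2 = 29 * rowWeightSum c := Real.sq_sqrt (by positivity)
    have hpos : 0 < ((level Qt : ℝ) + 1) ^ (1 + 2 * c) := by positivity
    calc (2 ^ level Qt * firstNorm Qt) ^ 2 / rowWeight c N (firstNorm Qt) (level Qt)
        = (2 ^ level Qt * firstNorm Qt) ^ 2 * (29 * rowWeightSum c) *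
            ((level Qt : ℝ) + 1) ^ (1 + 2 * c) * (1 + Real.log N) := by
          rw [rowWeight]
          field_simp
      _ ≤ (4 * gamma2 Q) ^ 2 * √(29 * rowWeightSum c) ^ 2 *
            (3 ^ (1 / 2 + c) * x ^ (1 / 2 + c)) ^ 2 * ((1 + Real.log N) ^ 3) ^ 2 := by
          rw [h6]
          gcongr
      _ = _ := by ring

end Algorithms

end OnlineFactorization

end

theorem theorem3 :
    (∀ c : ℝ, 0 < c →
      ∃ K : ℝ, 0 < K ∧ ∃ alg : (N : ℕ) → OnlineFactorization.RowArrivalAlgorithm N,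
        ∀ (m N : ℕ) (Q : Matrix (Fin m) (Fin N) ℝ),
          (Q = 0 → (alg N).AchievesValue Q 0) ∧
          ∀ s : Fin m, (∀ i : Fin m, i < s → Q i = 0) → Q s ≠ 0 →
            (alg N).AchievesValue Q
              (K * (OnlineFactorization.gamma2 Q *
                (1 + Real.log (OnlineFactorization.gamma2 Q / ‖Q s‖)) ^ (1 / 2 + c) *
                (1 + Real.log N) ^ 3))) ∧
    (∃ K : ℝ, 0 < K ∧ ∃ alg : (m : ℕ) → OnlineFactorization.ColumnArrivalAlgorithm m,
      ∀ (m N : ℕ) (A : Matrix (Fin m) (Fin N) ℝ),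
        (alg m).AchievesValue A
          (K * (OnlineFactorization.gamma2 A * (1 + Real.log m) ^ 3))) := by
  refine ⟨fun c hc => ?_, 25, by norm_num, ?_⟩
  · choose alg halg using fun N => OnlineFactorization.exists_rowArrivalAlgorithm hc N
    have := OnlineFactorization.rowWeightSum_pos hc
    exact ⟨_, by positivity, alg, fun m N Q => halg N m Q⟩
  · choose alg halg using OnlineFactorization.exists_columnArrivalAlgorithm
    exact ⟨alg, fun m N A => halg m N A⟩
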